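/- **Setting.** Let $\mathcal M=\{X\in\mathbb R^{n\times r}: X^{\mathsf T}X=I_r\}$, with Frobenius inner product and norm on $\mathbb R^{n\times r}$, and consider $\min_{X\in\mathcal M} f(X)-g(X)+h(\mathcal A(X))$. Here $\mathcal A:\mathbb R^{n\times r}\to\mathbb R^m$ is linear; $f$ is differentiable with $L_f$-Lipschitz gradient; $g$ is real-valued, convex and $C_g$-Lipschitz; $h:\mathbb R^m\to\mathbb R$ is $C_h$-Lipschitz, and $h+\frac{W_h}{2}\|\cdot\|^2$ is convex, with $W_h\ge0$. Write $\partial$ for the limiting subdifferential, $h_\mu(y)=\inf_u h(u)+\frac1{2\mu}\|u-y\|^2$, $\mathrm{prox}(b;\mu)=\arg\min_u h(u)+\frac{1}{2\mu}\|u-b\|^2$, $S(X,y,z,\beta)=f(X)+\langle z,\mathcal A(X)-y\rangle+\frac\beta2\|\mathcal A(X)-y\|^2$ and $L=S-g(X)+h_{\tau/\beta}(y)$. Let $\mathrm{Retr}$ be a retraction on $\mathcal M$: a smooth map $(X,\Delta)\mapsto \mathrm{Retr}_X(\Delta)\in\mathcal M$ on the tangent bundle with $\mathrm{Retr}_X(0)=X$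 and $\|\mathrm{Retr}_X(\Delta)-X-\Delta\|/\|\Delta\|\to0$ as $0\neq\Delta\to0$ in $T_X\mathcal M$. **Algorithm (OADMM-RR).** Parameters: $p=1/3$, $\xi>0$, $\sigma\in[1,2)$, $\tau\ge\frac{4}{2-\sigma}$, $\beta^0>0$ with $\beta^0\ge2\tau W_h$, $\rho>0$, $\gamma\in(0,1)$, $\delta\in(0,\frac1{\max(1,2\rho)})$, $0<\underline b<\overline b$. Start at $X^0\in\mathcal M$, $y^0,z^0\in\mathbb R^m$. For $t=0,1,\dots$, with $\beta^t=\beta^0(1+\xi t^p)$ and $\mu^t=\tau/\beta^t$: 1. Choose $G^t\in\nabla_XS(X^t,y^t,z^t,\beta^t)-\partial g(X^t)$, put $\mathbb G^t_\rho=G^t-\rho X^t(G^t)^{\mathsf T}X^t-(1-\rho)X^t(X^t)^{\mathsf T}G^t$, and choose any $b^t\in(\underline b,\overline b)$ (the Barzilai–Borwein step). Let $j\in\{0,1,\dots\}$ be the smallest integer such that, with $\eta=b^t\gamma^j/\beta^t$, $L(\mathrm{Retr}_{X^t}(-\eta\mathbb G^t_\rho),y^t,z^t,\beta^t)-L(X^t,y^t,z^t,\beta^t)\le-\delta\eta\|\mathbb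 G^t_\rho\|^2$, and set $X^{t+1}=\mathrm{Retr}_{X^t}(-\eta\mathbb G^t_\rho)$. 2. Set $\mathbf b=y^t-\frac1{\beta^t}\nabla_yS(X^{t+1},y^t,z^t,\beta^t)$, $y^{t+1}=\arg\min_y h_{\mu^t}(y)+\frac{\beta^t}2\|y-\mathbf b\|^2$ and $\breve y^{t+1}=\mathrm{prox}(\mathbf b;\mu^t+1/\beta^t)$. 3. Set $z^{t+1}=z^t+\sigma\beta^t(\mathcal A(X^{t+1})-y^{t+1})$. **Criticality.** For $X\in\mathcal M$, with $\mathrm{Proj}_{T_X\mathcal M}(\Delta)=\Delta-\frac12X(\Delta^{\mathsf T}X+X^{\mathsf T}\Delta)$ and the norm of a set meaning the infimum of the norms of its elements, let $\mathrm{Crit}(X,y,z)=\|\mathcal A(X)-y\|+\|\partial h(y)-z\|+\|\mathrm{Proj}_{T_X\mathcal M}(\nabla f(X)-\partial g(X)+\mathcal A^{\mathsf T}(z))\|$. The triple $(X,y,z)$ is an $\epsilon$-stationary point if $X\in\mathcal M$ and $\mathrm{Crit}(X,y,z)\le\epsilon$. **Theorem.** There are constants $J\in\mathbb N$ and $C,K>0$,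 depending only on the problem, the retraction, the parameters and the starting point (not on the iteration, on $T$, on $\epsilon$, or on the choices of $G^t$ and $b^t$), such that: (i) in every iteration the line search terminates after at most $J$ trials; (ii) for every $T\ge1$, $\ \frac1T\sum_{t=1}^T\mathrm{Crit}(X^{t+1},\breve y^{t+1},z^{t+1})\le C\,T^{-1/3}$; (iii) for every $\epsilon>0$ and every integer $T\ge1$ with $T\ge K/\epsilon^3$ there is $\bar t\in\{1,\dots,T\}$ such that $(X^{\bar t+1},\breve y^{\bar t+1},z^{\bar t+1})$ is an $\epsilon$-stationary point. -/

import Mathlib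

open Set Filter Topology
open scoped NNReal ENNReal Matrix ContDiff

noncomputable section

namespace OADMM

/-! ### Matrices, the Stiefel manifold, retractions -/

/-- The space of real `n × r` matrices with the Frobenius inner product and norm. -/
abbrev Mat (n r : ℕ) : Type := EuclideanSpace ℝ (Fin n × Fin r)

/-- The space `ℝ^m` with the Euclidean inner product and norm. -/
abbrev Vec (m : ℕ) : Type := EuclideanSpace ℝ (Fin m)

variable {n r m : ℕ}

/-- The entries of an element of `Mat n r`, as a matrix. -/
def Mat.toMatrix (X : Mat n r) : Matrix (Fin n) (Fin r) ℝ :=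
  Matrix.of fun i j => X (i, j)

/-- The element of `Mat n r` with the given entries. -/
def Mat.ofMatrix (M : Matrix (Fin n) (Fin r) ℝ) : Mat n r :=
  WithLp.toLp 2 fun ij => M ij.1 ij.2

/-- The Stiefel manifold `{X : Xᵀ X = I}`. -/
def stiefel (n r : ℕ) : Set (Mat n r) :=
  {X | X.toMatrixᵀ * X.toMatrix = 1}

/-- The tangent space of the Stiefel manifold at `X`: all `D` with `Xᵀ D + Dᵀ X = 0`. -/
def tangent (X : Mat n r) : Set (Mat n r) :=
  {D | X.toMatrixᵀ * D.toMatrix + D.toMatrixᵀ * X.toMatrix = 0}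

/-- The projection of `D` onto the tangent space at `X`, namely `D - (1/2) X (Dᵀ X + Xᵀ D)`. -/
def tangentProj (X D : Mat n r) : Mat n r :=
  Mat.ofMatrix (D.toMatrix - (1 / 2 : ℝ) •
    (X.toMatrix * (D.toMatrixᵀ * X.toMatrix + X.toMatrixᵀ * D.toMatrix)))

/-- The search direction `G - ρ X Gᵀ X - (1 - ρ) X Xᵀ G`. -/
def searchDir (ρ : ℝ) (X G : Mat n r) : Mat n r :=
  Mat.ofMatrix (G.toMatrix - ρ • (X.toMatrix * G.toMatrixᵀ * X.toMatrix)
    - (1 - ρ) • (X.toMatrix * X.toMatrixᵀ * G.toMatrix))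

/-- `R` is a retraction on the Stiefel manifold: a smooth map from the tangent bundle to the
manifold with `R X 0 = X` and `R X D = X + D + o(‖D‖)` for tangent vectors `D → 0`.
Smoothness on the embedded submanifold `{(X, D) : X ∈ M, D ∈ T_X M}` is `ContDiffOn` on
that subset of the ambient vector space; values off the tangent bundle play no role. -/
structure IsRetraction (R : Mat n r → Mat n r → Mat n r) : Prop where
  mem : ∀ X ∈ stiefel n r, ∀ D ∈ tangent X, R X D ∈ stiefel n r
  smooth : ContDiffOn ℝ ∞ (fun q : Mat n r × Mat n r => R q.1 q.2)
    {q | q.1 ∈ stiefel n r ∧ q.2 ∈ tangent q.1}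
  zero : ∀ X ∈ stiefel n r, R X 0 = X
  first_order : ∀ X ∈ stiefel n r,
    Tendsto (fun D => ‖R X D - X - D‖ / ‖D‖) (𝓝[tangent X \ {0}] 0) (𝓝 0)

/-! ### Subdifferentials, proximal points, Moreau envelopes -/

section Nonsmooth

variable {E : Type*} [NormedAddCommGroup E] [InnerProductSpace ℝ E]

/-- The Fréchet subdifferential: all `w` with
`liminf_{u → x, u ≠ x} (F u - F x - ⟪w, u - x⟫) / ‖u - x‖ ≥ 0`. -/
def frechetSubdiff (F : E → ℝ) (x : E) : Set E :=
  {w | ∀ ε > 0, ∀ᶠ u in 𝓝 x, F x + inner ℝ w (u - x) - ε * ‖u - x‖ ≤ F u}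

/-- The limiting subdifferential. -/
def limitingSubdiff (F : E → ℝ) (x : E) : Set E :=
  {w | ∃ (u : ℕ → E) (v : ℕ → E), Tendsto u atTop (𝓝 x) ∧
    Tendsto (fun k => F (u k)) atTop (𝓝 (F x)) ∧
    (∀ k, v k ∈ frechetSubdiff F (u k)) ∧ Tendsto v atTop (𝓝 w)}

/-- The objective `y ↦ h y + ‖y - b‖² / (2 μ)` of the proximal problem. -/
def proxObj (h : E → ℝ) (μ : ℝ) (b y : E) : ℝ :=
  h y + 1 / (2 * μ) * ‖y - b‖ ^ 2

/-- `q` is a proximal point of `b`: a global minimizer of the proximal problem. -/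
def IsProx (h : E → ℝ) (μ : ℝ) (b q : E) : Prop :=
  IsMinOn (proxObj h μ b) univ q

/-- The Moreau envelope of `h` with parameter `μ`. -/
def moreau (h : E → ℝ) (μ : ℝ) (y : E) : ℝ :=
  ⨅ u : E, proxObj h μ y u

end Nonsmooth

/-! ### The optimization problem -/

/-- The data of the problem: minimize `f X - g X + h (A X)` over the Stiefel manifold. -/
structure Problem (n r m : ℕ) where
  f : Mat n r → ℝ
  g : Mat n r → ℝ
  h : Vec m → ℝ
  A : Mat n r →L[ℝ] Vec m

/-- The standing assumptions: `f` is `Lf`-smooth, `g` is convex and `Cg`-Lipschitz, `h` is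
`Ch`-Lipschitz and weakly convex with constant `Wh ≥ 0`. -/
structure Problem.Assumptions (P : Problem n r m) (Lf Cg Ch : ℝ≥0) (Wh : ℝ) : Prop where
  f_diff : Differentiable ℝ P.f
  f_smooth : LipschitzWith Lf (gradient P.f)
  g_convex : ConvexOn ℝ univ P.g
  g_lip : LipschitzWith Cg P.g
  h_lip : LipschitzWith Ch P.h
  Wh_nonneg : 0 ≤ Wh
  h_weaklyConvex : ConvexOn ℝ univ fun y => P.h y + Wh / 2 * ‖y‖ ^ 2

/-- The criticality measure
`‖A X - y‖ + ‖∂h(y) - z‖ + ‖Proj_{T_X M} (∇f(X) - ∂g(X) + Aᵀ z)‖`,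
where the norm of a set is the infimum of the norms of its elements. The values are
extended nonnegative reals, so that the norm of an empty set is `∞`. -/
def Problem.crit (P : Problem n r m) (X : Mat n r) (y z : Vec m) : ℝ≥0∞ :=
  ‖P.A X - y‖ₑ + (⨅ w ∈ limitingSubdiff P.h y, ‖w - z‖ₑ) +
    ⨅ v ∈ limitingSubdiff P.g X,
      ‖tangentProj X (gradient P.f X - v + ContinuousLinearMap.adjoint P.A z)‖ₑ

/-- `(X, y, z)` is an `ε`-stationary point. -/
def Problem.IsStationary (P : Problem n r m) (ε : ℝ) (X : Mat n r) (y z : Vec m) : Prop :=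
  X ∈ stiefel n r ∧ P.crit X y z ≤ ENNReal.ofReal ε

/-- The smooth part `f X + ⟪z, A X - y⟫ + (β/2) ‖A X - y‖²` of the augmented Lagrangian. -/
def Problem.smoothPart (P : Problem n r m) (X : Mat n r) (y z : Vec m) (β : ℝ) : ℝ :=
  P.f X + inner ℝ z (P.A X - y) + β / 2 * ‖P.A X - y‖ ^ 2

/-- The augmented Lagrangian at `X` in the Stiefel manifold (where the indicator function of
the manifold vanishes), with smoothing parameter `μ = τ / β`. -/
def Problem.lagrangian (P : Problem n r m) (τ : ℝ) (X : Mat n r) (y z : Vec m) (β : ℝ) : ℝ :=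
  P.smoothPart X y z β - P.g X + moreau P.h (τ / β) y

/-! ### The algorithm -/

/-- The parameters of the algorithm. -/
structure Params where
  p : ℝ
  ξ : ℝ
  σ : ℝ
  τ : ℝ
  β₀ : ℝ
  ρ : ℝ
  γ : ℝ
  δ : ℝ
  bLow : ℝ
  bHigh : ℝ

/-- The admissible choices of the parameters. -/
structure Params.Valid (a : Params) (Wh : ℝ) : Prop where
  p_pos : 0 < a.p
  p_lt : a.p < 1
  ξ_pos : 0 < a.ξ
  one_le_σ : 1 ≤ a.σ
  σ_lt : a.σ < 2
  τ_ge : 4 / (2 - a.σ) ≤ a.τ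
  β₀_pos : 0 < a.β₀
  β₀_ge : 2 * a.τ * Wh ≤ a.β₀
  ρ_pos : 0 < a.ρ
  γ_pos : 0 < a.γ
  γ_lt : a.γ < 1
  δ_pos : 0 < a.δ
  δ_lt : a.δ < 1 / max 1 (2 * a.ρ)
  bLow_pos : 0 < a.bLow
  bLow_lt : a.bLow < a.bHigh

/-- The penalty parameter `β^t = β⁰ (1 + ξ t^p)`. -/
def Params.β (a : Params) (t : ℕ) : ℝ := a.β₀ * (1 + a.ξ * (t : ℝ) ^ a.p)

/-- The quantities that the algorithm produces. At iteration `t` it picks a subgradient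
`v t` of `g` at `X t`, a stepsize `b t`, runs the line search, whose final exponent is `j t`,
and computes `X (t + 1)`, `y (t + 1)`, `yBr (t + 1)` (the auxiliary proximal point)
and `z (t + 1)`. -/
structure Iterates (n r m : ℕ) where
  X : ℕ → Mat n r
  y : ℕ → Vec m
  yBr : ℕ → Vec m
  z : ℕ → Vec m
  v : ℕ → Mat n r
  b : ℕ → ℝ
  j : ℕ → ℕ

/-- The direction `𝔾_ρ^t` built from `G^t = ∇_X S(X, y, z, β) - v`. -/
def Problem.direction (P : Problem n r m) (ρ β : ℝ) (X : Mat n r) (y z : Vec m)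
    (v : Mat n r) : Mat n r :=
  searchDir ρ X (gradient (fun X' => P.smoothPart X' y z β) X - v)

/-- The line search test with stepsize `η` along `-D`, at the point `X`. -/
def Problem.LineSearchTest (P : Problem n r m) (R : Mat n r → Mat n r → Mat n r)
    (a : Params) (β : ℝ) (X : Mat n r) (y z : Vec m) (D : Mat n r) (η : ℝ) : Prop :=
  P.lagrangian a.τ (R X (-(η • D))) y z β - P.lagrangian a.τ X y z β
    ≤ -(a.δ * η * ‖D‖ ^ 2)

/-- In iteration `t` with subgradient `v` and initial stepsize `b`, the trial number
`j` (counted from `0`), which has stepsize `b γ^j / β^t`, passes the line search test. -/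
def Problem.TrialSucceeds (P : Problem n r m) (R : Mat n r → Mat n r → Mat n r)
    (a : Params) (s : Iterates n r m) (t : ℕ) (v : Mat n r) (b : ℝ) (j : ℕ) : Prop :=
  P.LineSearchTest R a (a.β t) (s.X t) (s.y t) (s.z t)
    (P.direction a.ρ (a.β t) (s.X t) (s.y t) (s.z t) v) (b * a.γ ^ j / a.β t)

/-- The center `y^t - ∇_y S(X^{t+1}, y^t, z^t, β^t) / β^t` of the `y`-subproblem. -/
def Problem.center (P : Problem n r m) (a : Params) (s : Iterates n r m) (t : ℕ) : Vec m :=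
  s.y t - (1 / a.β t) •
    gradient (fun y' => P.smoothPart (s.X (t + 1)) y' (s.z t) (a.β t)) (s.y t)

/-- Iteration `t` is carried out according to the algorithm. -/
structure Problem.IsStep (P : Problem n r m) (R : Mat n r → Mat n r → Mat n r)
    (a : Params) (s : Iterates n r m) (t : ℕ) : Prop where
  v_mem : s.v t ∈ limitingSubdiff P.g (s.X t)
  b_mem : s.b t ∈ Ioo a.bLow a.bHigh
  j_least : IsLeast {j | P.TrialSucceeds R a s t (s.v t) (s.b t) j} (s.j t)
  X_succ : s.X (t + 1) = R (s.X t) (-((s.b t * a.γ ^ s.j t / a.β t) •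
    P.direction a.ρ (a.β t) (s.X t) (s.y t) (s.z t) (s.v t)))
  y_succ : IsMinOn
    (fun u => moreau P.h (a.τ / a.β t) u + a.β t / 2 * ‖u - P.center a s t‖ ^ 2)
    univ (s.y (t + 1))
  yBr_succ : IsProx P.h (a.τ / a.β t + 1 / a.β t) (P.center a s t) (s.yBr (t + 1))
  z_succ : s.z (t + 1) = s.z t + (a.σ * a.β t) • (P.A (s.X (t + 1)) - s.y (t + 1))

/-- `s` starts at `(X₀, y₀, z₀)` and its iterations `0, …, N - 1` are carried out according to
the algorithm. Nothing is required of the later entries. -/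
structure Problem.IsRun (P : Problem n r m) (R : Mat n r → Mat n r → Mat n r)
    (a : Params) (X₀ : Mat n r) (y₀ z₀ : Vec m) (N : ℕ) (s : Iterates n r m) : Prop where
  X_zero : s.X 0 = X₀
  y_zero : s.y 0 = y₀
  z_zero : s.z 0 = z₀
  step : ∀ t < N, P.IsStep R a s t

end OADMM

end

/-!
The augmented Lagrangian `L` is a potential for the algorithm. The `X`-step lowers it by a multiple
of `‖𝔾^t‖² / β^t`, because the stepsize found by the line search is at least a constant over `β^t`,
and the `y`-step lowers it by `(3/8) β^t ‖y^{t+1} - y^t‖²` (`ProxPair.growth`). It grows in the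
multiplier step, by `‖z^{t+1} - z^t‖² / (σ β^t)`, and when the penalty changes.

The first growth is absorbed by the `y`-step. Let `w^{t+1} = z^t + β^t (A X^{t+1} - y^{t+1})`, which
is the gradient of the Moreau envelope at `y^{t+1}` and a subgradient of `h` at the proximal
point `yBr^{t+1}` (`proxPair_of_isMinOn`). Then `z^{t+1} = (1 - σ) z^t + σ w^{t+1}`, so the
increments of `z` contract with factor `σ - 1 < 1` up to `σ ‖w^{t+1} - w^t‖`, and this is at most
`σ (β^t / τ) ‖y^{t+1} - y^t‖` plus the effect of the change of the smoothing parameter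
(`ProxPair.norm_gradient_sub_le`); the condition `τ (2 - σ) ≥ 4` makes the resulting coefficient
small enough (`norm_z_sub_sq_le`). All remaining errors are multiples of `1/β^t - 1/β^{t+1}` and
telescope (`lagrangian_descent`). Since `‖w^t‖ ≤ Ch`, the multipliers are bounded, and with them
all other quantities, in particular the potential from below. Hence `∑ ‖𝔾^t‖² / β^t` and
`∑ ‖z^{t+1} - z^t‖² / β^t` are bounded uniformly (`exists_sum_bound`).

The line search succeeds uniformly early because of the descent lemma for the smooth part, the
subgradient inequality for `g`, the estimate `⟪G, 𝔾⟫ ≥ ‖𝔾‖² / max (1, 2ρ)`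
(`norm_searchDir_sq_le`), and the expansion `R X D = X + D + O(‖D‖²)`, uniform in `X` because the
Stiefel manifold is compact (`IsRetraction.exists_second_order_bound`).

The criticality measure after iteration `t` is at most a multiple of
`‖z^{t+1} - z^t‖ + 1 / β^t + ‖𝔾^{t+1}‖` (`Problem.IsStep.crit_le`). As `β^t` grows like `t^(1/3)`,
the arithmetic-geometric mean inequality turns the two square sums into sums of order
`(T · T^(1/3))^(1/2) = T^(2/3)`, and `∑ 1 / β^t` is of the same order.
-/

namespace OADMM

/-! ### Subgradients of Lipschitz and of convex functions -/

section Nonsmooth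

variable {E : Type*} [NormedAddCommGroup E] [InnerProductSpace ℝ E]

theorem norm_le_of_mem_frechetSubdiff {F : E → ℝ} {L : ℝ≥0} (hF : LipschitzWith L F) {x w : E}
    (hw : w ∈ frechetSubdiff F x) : ‖w‖ ≤ L := by
  refine le_of_forall_pos_le_add fun ε hε => ?_
  by_cases hw0 : ‖w‖ = 0
  · rw [hw0]; positivity
  have hwpos : 0 < ‖w‖ := lt_of_le_of_ne (norm_nonneg _) (Ne.symm hw0)
  have hcont : Tendsto (fun s : ℝ => x + s • w) (𝓝[>] 0) (𝓝 x) := by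
    have : Continuous fun s : ℝ => x + s • w := by fun_prop
    simpa using (this.tendsto 0).mono_left nhdsWithin_le_nhds
  obtain ⟨s, hs, hs0⟩ := ((hcont.eventually (hw ε hε)).and self_mem_nhdsWithin).exists
  have hs0 : 0 < s := hs0
  have h2 := (abs_le.mp (hF.dist_le_mul (x + s • w) x)).2
  simp only [add_sub_cancel_left, inner_smul_right, real_inner_self_eq_norm_sq, norm_smul,
    Real.norm_eq_abs, abs_of_pos hs0, dist_eq_norm] at hs h2
  have h3 : s * ‖w‖ * ‖w‖ ≤ s * ‖w‖ * (L + ε) := by nlinarith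
  exact le_of_mul_le_mul_left h3 (by positivity)

theorem norm_le_of_mem_limitingSubdiff {F : E → ℝ} {L : ℝ≥0} (hF : LipschitzWith L F) {x w : E}
    (hw : w ∈ limitingSubdiff F x) : ‖w‖ ≤ L := by
  obtain ⟨u, v, -, -, hv, hvw⟩ := hw
  exact le_of_tendsto' hvw.norm fun k => norm_le_of_mem_frechetSubdiff hF (hv k)

theorem frechetSubdiff_subset_limitingSubdiff (F : E → ℝ) (x : E) :
    frechetSubdiff F x ⊆ limitingSubdiff F x := fun w hw =>
  ⟨fun _ => x, fun _ => w, tendsto_const_nhds, tendsto_const_nhds, fun _ => hw,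
    tendsto_const_nhds⟩

theorem le_sub_of_mem_frechetSubdiff {F : E → ℝ} (hF : ConvexOn ℝ univ F) {x w : E}
    (hw : w ∈ frechetSubdiff F x) (x' : E) : inner ℝ w (x' - x) ≤ F x' - F x := by
  refine le_of_forall_pos_le_add fun ε hε => ?_
  set ε' := ε / (‖x' - x‖ + 1) with hε'
  have hε'0 : 0 < ε' := by positivity
  have hε'le : ε' * ‖x' - x‖ ≤ ε := by
    rw [hε', div_mul_eq_mul_div, div_le_iff₀ (by positivity)]
    nlinarith [norm_nonneg (x' - x)]
  have hcont : Tendsto (fun s : ℝ => x + s • (x' - x)) (𝓝[>] 0) (𝓝 x) := by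
    have : Continuous fun s : ℝ => x + s • (x' - x) := by fun_prop
    simpa using (this.tendsto 0).mono_left nhdsWithin_le_nhds
  obtain ⟨s, hs, hs0, hs1⟩ := ((hcont.eventually (hw ε' hε'0)).and
    (Ioo_mem_nhdsGT (zero_lt_one' ℝ))).exists
  have hc := hF.2 (mem_univ x) (mem_univ x') (sub_nonneg.2 hs1.le) hs0.le (by ring)
  have he : (1 - s) • x + s • x' = x + s • (x' - x) := by module
  rw [he] at hc
  simp only [add_sub_cancel_left, inner_smul_right, norm_smul, Real.norm_eq_abs,
    abs_of_pos hs0, smul_eq_mul] at hs hc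
  have h3 : s * inner ℝ w (x' - x) ≤ s * (F x' - F x + ε) := by nlinarith
  exact le_of_mul_le_mul_left h3 hs0

theorem le_sub_of_mem_limitingSubdiff {F : E → ℝ} (hF : ConvexOn ℝ univ F) {x w : E}
    (hw : w ∈ limitingSubdiff F x) (x' : E) : inner ℝ w (x' - x) ≤ F x' - F x := by
  obtain ⟨u, v, hu, hFu, hv, hvw⟩ := hw
  exact le_of_tendsto_of_tendsto' (hvw.inner (tendsto_const_nhds.sub hu))
    (tendsto_const_nhds.sub hFu) fun k => le_sub_of_mem_frechetSubdiff hF (hv k) x'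

/-- A real Lipschitz function has limiting subgradients everywhere: by Rademacher's theorem there
are points of differentiability arbitrarily close by, and the gradients there are bounded. -/
theorem limitingSubdiff_nonempty [FiniteDimensional ℝ E] {F : E → ℝ} {L : ℝ≥0}
    (hF : LipschitzWith L F) (x : E) : (limitingSubdiff F x).Nonempty := by
  let _ : MeasurableSpace E := borel E
  have : BorelSpace E := ⟨rfl⟩
  have hd : Dense {u | DifferentiableAt ℝ F u} :=
    MeasureTheory.Measure.dense_of_ae (hF.ae_differentiableAt (μ := MeasureTheory.volume))
  obtain ⟨u, hu, hux⟩ := mem_closure_iff_seq_limit.1 (hd x)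
  have hg : ∀ k, gradient F (u k) ∈ frechetSubdiff F (u k) := by
    intro k ε hε
    have h1 := (hasGradientAt_iff_isLittleO.1 (hu k).hasGradientAt).def hε
    filter_upwards [h1] with y hy
    have := (abs_le.1 ((Real.norm_eq_abs _) ▸ hy)).1
    linarith
  have hb : ∀ k, gradient F (u k) ∈ Metric.closedBall (0 : E) L := fun k => by
    simpa using norm_le_of_mem_frechetSubdiff hF (hg k)
  obtain ⟨w, -, φ, hφ, hw⟩ := (isCompact_closedBall (0 : E) L).tendsto_subseq hb
  have hux' := hux.comp hφ.tendsto_atTop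
  exact ⟨w, u ∘ φ, fun k => gradient F (u (φ k)), hux',
    (hF.continuous.tendsto x).comp hux', fun k => hg _, hw⟩

/-! ### Proximal points and the Moreau envelope of a weakly convex function -/

/-- `w` is a subgradient of `h` at `u` in the quadratic sense suited to functions `h` for which
`h + (W / 2) ‖·‖²` is convex: the subgradient inequality holds up to `(W / 2) ‖v - u‖²`. -/
def WeakSubgradient (h : E → ℝ) (W : ℝ) (u w : E) : Prop :=
  ∀ v, h u + inner ℝ w (v - u) - W / 2 * ‖v - u‖ ^ 2 ≤ h v

theorem WeakSubgradient.mem_frechetSubdiff {h : E → ℝ} {W : ℝ} (hW : 0 ≤ W) {u w : E}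
    (hw : WeakSubgradient h W u w) : w ∈ frechetSubdiff h u := by
  intro ε hε
  have : ∀ᶠ v in 𝓝 u, ‖v - u‖ < ε / (W + 1) := by
    have := Metric.ball_mem_nhds u (ε := ε / (W + 1)) (by positivity)
    filter_upwards [this] with v hv
    rwa [← dist_eq_norm]
  filter_upwards [this] with v hv
  have h1 := hw v
  rw [lt_div_iff₀ (by positivity)] at hv
  nlinarith [norm_nonneg (v - u)]

/-- First-order optimality of a proximal point. -/
theorem IsProx.weakSubgradient {h : E → ℝ} {W : ℝ}
    (hh : ConvexOn ℝ univ fun y => h y + W / 2 * ‖y‖ ^ 2) {ν : ℝ} {b u : E}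
    (hu : IsProx h ν b u) : WeakSubgradient h W u ((1 / ν) • (b - u)) := by
  intro v
  -- it suffices to move from `u` towards `v` by a small step `s`, up to an error of order `s`
  set M := |W| + |1 / ν| with hM
  have key : ∀ s : ℝ, 0 < s → s < 1 →
      h u + inner ℝ ((1 / ν) • (b - u)) (v - u) - W / 2 * ‖v - u‖ ^ 2
        ≤ h v + s * (M * ‖v - u‖ ^ 2) := by
    intro s hs0 hs1
    have hc := hh.2 (mem_univ u) (mem_univ v) (sub_nonneg.2 hs1.le) hs0.le (by ring)
    have he : (1 - s) • u + s • v = u + s • (v - u) := by module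
    have hmin : proxObj h ν b u ≤ proxObj h ν b (u + s • (v - u)) := hu (mem_univ _)
    have e1 : ‖u + s • (v - u)‖ ^ 2 = ‖u‖ ^ 2 + 2 * s * inner ℝ u (v - u)
        + s ^ 2 * ‖v - u‖ ^ 2 := by
      rw [norm_add_sq_real, inner_smul_right, norm_smul, mul_pow, Real.norm_eq_abs, sq_abs]; ring
    have e2 : ‖u + s • (v - u) - b‖ ^ 2 = ‖u - b‖ ^ 2 - 2 * s * inner ℝ (b - u) (v - u)
        + s ^ 2 * ‖v - u‖ ^ 2 := by
      have : u + s • (v - u) - b = (u - b) + s • (v - u) := by abel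
      rw [this, norm_add_sq_real, inner_smul_right, norm_smul, mul_pow, Real.norm_eq_abs, sq_abs,
        ← neg_sub b u, inner_neg_left, norm_neg]; ring
    have e3 : ‖v‖ ^ 2 = ‖u‖ ^ 2 + 2 * inner ℝ u (v - u) + ‖v - u‖ ^ 2 := by
      have : v = u + (v - u) := by abel
      conv_lhs => rw [this]
      rw [norm_add_sq_real]
    rw [he] at hc
    unfold proxObj at hmin
    simp only [smul_eq_mul] at hc
    rw [e2] at hmin
    rw [e1, e3] at hc
    rw [inner_smul_left]
    simp only [conj_trivial]
    have h1 : 1 / (2 * ν) = 1 / ν / 2 := by rw [one_div, mul_inv, one_div]; ring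
    rw [h1] at hmin
    set c := 1 / ν
    set n2 := ‖v - u‖ ^ 2
    have hn2 : 0 ≤ n2 := by positivity
    have hWa := le_abs_self W
    have hWb := neg_abs_le W
    have hca := le_abs_self c
    have hcb := neg_abs_le c
    have h4 : s * (h u + c * inner ℝ (b - u) (v - u) - W / 2 * n2)
        ≤ s * (h v + s / 2 * (c - W) * n2) := by nlinarith
    have h5 := le_of_mul_le_mul_left h4 hs0
    have h6 : s / 2 * (c - W) * n2 ≤ s * (M * n2) := by
      have : (c - W) * n2 ≤ 2 * M * n2 := by
        apply mul_le_mul_of_nonneg_right _ hn2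
        rw [hM]
        have := abs_nonneg W
        have := abs_nonneg c
        linarith
      nlinarith
    linarith
  have hlim : Tendsto (fun s : ℝ => h v + s * (M * ‖v - u‖ ^ 2)) (𝓝[>] 0) (𝓝 (h v)) := by
    have : Continuous fun s : ℝ => h v + s * (M * ‖v - u‖ ^ 2) := by fun_prop
    simpa using (this.tendsto 0).mono_left nhdsWithin_le_nhds
  refine ge_of_tendsto hlim ?_
  filter_upwards [Ioo_mem_nhdsGT (zero_lt_one' ℝ)] with s hs using key s hs.1 hs.2

omit [InnerProductSpace ℝ E] in
theorem proxObj_ge {h : E → ℝ} {L : ℝ≥0} (hh : LipschitzWith L h) {μ : ℝ} (hμ : 0 < μ) (y u : E) :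
    h y - μ * L ^ 2 / 2 ≤ proxObj h μ y u := by
  unfold proxObj
  have h1 := (abs_le.1 (hh.dist_le_mul u y)).1
  rw [dist_eq_norm] at h1
  have h2 : L * ‖u - y‖ ≤ 1 / (2 * μ) * ‖u - y‖ ^ 2 + μ * L ^ 2 / 2 := by
    rw [← sub_nonneg]
    have : 1 / (2 * μ) * ‖u - y‖ ^ 2 + μ * L ^ 2 / 2 - L * ‖u - y‖
      = 1 / (2 * μ) * (‖u - y‖ - μ * L) ^ 2 := by field_simp; ring
    rw [this]; positivity
  linarith

omit [InnerProductSpace ℝ E] in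
theorem bddBelow_proxObj {h : E → ℝ} {L : ℝ≥0} (hh : LipschitzWith L h) {μ : ℝ} (hμ : 0 < μ)
    (y : E) : BddBelow (range fun u => proxObj h μ y u) :=
  ⟨h y - μ * L ^ 2 / 2, by rintro _ ⟨u, rfl⟩; exact proxObj_ge hh hμ y u⟩

omit [InnerProductSpace ℝ E] in
theorem moreau_le {h : E → ℝ} {L : ℝ≥0} (hh : LipschitzWith L h) {μ : ℝ} (hμ : 0 < μ) (y u : E) :
    moreau h μ y ≤ proxObj h μ y u := ciInf_le (bddBelow_proxObj hh hμ y) u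

omit [InnerProductSpace ℝ E] in
theorem moreau_ge {h : E → ℝ} {L : ℝ≥0} (hh : LipschitzWith L h) {μ : ℝ} (hμ : 0 < μ) (y : E) :
    h y - μ * L ^ 2 / 2 ≤ moreau h μ y := le_ciInf fun u => proxObj_ge hh hμ y u

omit [InnerProductSpace ℝ E] in
theorem moreau_le_self {h : E → ℝ} {L : ℝ≥0} (hh : LipschitzWith L h) {μ : ℝ} (hμ : 0 < μ)
    (y : E) : moreau h μ y ≤ h y := (moreau_le hh hμ y y).trans_eq (by simp [proxObj])

/-- A pair `(u, y)` with `w = (y - u) / μ` a subgradient of `h` at `u`: then `u` is the proximal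
point of `y` and `w` is the gradient of the Moreau envelope of `h` at `y`. -/
structure ProxPair (h : E → ℝ) (W μ : ℝ) (u y w : E) : Prop where
  eq : y - u = μ • w
  sub : WeakSubgradient h W u w

namespace ProxPair

variable {h : E → ℝ} {W μ : ℝ} {u y w : E}

theorem norm_le {L : ℝ≥0} (hh : LipschitzWith L h) (hW : 0 ≤ W) (hp : ProxPair h W μ u y w) :
    ‖w‖ ≤ L := norm_le_of_mem_frechetSubdiff hh (hp.sub.mem_frechetSubdiff hW)

theorem moreau_eq {L : ℝ≥0} (hh : LipschitzWith L h) (hμ : 0 < μ) (hWμ : W * μ ≤ 1)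
    (hp : ProxPair h W μ u y w) : moreau h μ y = h u + μ / 2 * ‖w‖ ^ 2 := by
  have e : proxObj h μ y u = h u + μ / 2 * ‖w‖ ^ 2 := by
    unfold proxObj
    rw [← norm_neg, neg_sub, hp.eq, norm_smul, mul_pow, Real.norm_eq_abs, sq_abs]
    field_simp
  refine le_antisymm ((moreau_le hh hμ y u).trans_eq e) (le_ciInf fun v => ?_)
  have h1 := hp.sub v
  unfold proxObj
  have e2 : v - y = (v - u) - μ • w := by rw [← hp.eq]; abel
  rw [e2, norm_sub_sq_real, inner_smul_right, norm_smul, mul_pow, Real.norm_eq_abs, sq_abs,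
    real_inner_comm]
  have e3 : 1 / (2 * μ) * (‖v - u‖ ^ 2 - 2 * (μ * inner ℝ w (v - u)) + μ ^ 2 * ‖w‖ ^ 2)
      = 1 / (2 * μ) * ‖v - u‖ ^ 2 - inner ℝ w (v - u) + μ / 2 * ‖w‖ ^ 2 := by
    field_simp
  rw [e3]
  have h4 : W / 2 * ‖v - u‖ ^ 2 ≤ 1 / (2 * μ) * ‖v - u‖ ^ 2 := by
    apply mul_le_mul_of_nonneg_right _ (by positivity)
    rw [le_div_iff₀ (by positivity)]; linarith
  linarith

/-- The envelope grows at a controlled rate when its parameter decreases. -/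
theorem moreau_le_add {L : ℝ≥0} (hh : LipschitzWith L h) (hW : 0 ≤ W) (hμ : 0 < μ)
    (hWμ : W * μ ≤ 1) (hp : ProxPair h W μ u y w) {μ' : ℝ} (hμ' : 0 < μ') (hle : μ' ≤ μ) :
    moreau h μ' y ≤ moreau h μ y + (1 / μ' - 1 / μ) * (μ ^ 2 * L ^ 2 / 2) := by
  rw [hp.moreau_eq hh hμ hWμ]
  refine (moreau_le hh hμ' y u).trans ?_
  unfold proxObj
  rw [← norm_neg, neg_sub, hp.eq, norm_smul, mul_pow, Real.norm_eq_abs, sq_abs]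
  have h1 : ‖w‖ ^ 2 ≤ L ^ 2 := pow_le_pow_left₀ (norm_nonneg _) (hp.norm_le hh hW) 2
  have h2 : 0 ≤ 1 / μ' - 1 / μ := by
    rw [sub_nonneg]; exact one_div_le_one_div_of_le hμ' hle
  have h3 : 1 / (2 * μ') * (μ ^ 2 * ‖w‖ ^ 2)
      = μ / 2 * ‖w‖ ^ 2 + (1 / μ' - 1 / μ) * (μ ^ 2 * ‖w‖ ^ 2 / 2) := by
    field_simp; ring
  rw [h3, add_assoc]
  gcongr

/-- Stability of the gradient of the Moreau envelope in the point and in the parameter. -/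
theorem norm_gradient_sub_le {L : ℝ≥0} (hh : LipschitzWith L h) (hW : 0 ≤ W) (hμ : 0 < μ)
    (hWμ : 2 * (W * μ) ≤ 1) (hp : ProxPair h W μ u y w) {μ' : ℝ} {u' y' w' : E}
    (hp' : ProxPair h W μ' u' y' w') :
    μ * ‖w - w'‖ ≤ ‖y - y'‖ + |μ - μ'| * L := by
  set d := (y - y') - (μ - μ') • w' with hd
  have hdle : ‖d‖ ≤ ‖y - y'‖ + |μ - μ'| * L := by
    refine (norm_sub_le _ _).trans ?_
    rw [norm_smul, Real.norm_eq_abs]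
    gcongr
    exact hp'.norm_le hh hW
  refine le_trans ?_ hdle
  set e := μ • (w - w') with he
  have hne : μ * ‖w - w'‖ = ‖e‖ := by rw [he, norm_smul, Real.norm_eq_abs, abs_of_pos hμ]
  rw [hne]
  have huu : u - u' = d - e := by
    have h1 := hp.eq
    have h2 := hp'.eq
    have : u = y - μ • w := by rw [← h1]; abel
    rw [this]
    have : u' = y' - μ' • w' := by rw [← h2]; abel
    rw [this, hd, he]; module
  have h1 := hp.sub u'
  have h2 := hp'.sub u
  have hmono : -(W * ‖u - u'‖ ^ 2) ≤ inner ℝ (w - w') (u - u') := by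
    rw [inner_sub_left]
    rw [← neg_sub u u', inner_neg_right, norm_neg] at h1
    linarith
  have h3 : -(μ * W * ‖d - e‖ ^ 2) ≤ inner ℝ e (d - e) := by
    rw [huu] at hmono
    rw [he, inner_smul_left]
    simp only [conj_trivial]
    rw [← he]
    nlinarith
  rw [inner_sub_right, real_inner_self_eq_norm_sq, norm_sub_sq_real] at h3
  have h4 := real_inner_le_norm e d
  rw [real_inner_comm e d] at h3
  set θ := μ * W with hθ
  have hθ0 : 0 ≤ θ := by positivity
  have hθ1 : 2 * θ ≤ 1 := by rw [hθ]; linarith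
  -- this inequality factors as `(‖e‖ - ‖d‖) ((1 - θ) ‖e‖ + θ ‖d‖) ≤ 0`
  have h5 : (1 - θ) * ‖e‖ ^ 2 ≤ (1 - 2 * θ) * (‖e‖ * ‖d‖) + θ * ‖d‖ ^ 2 := by
    rw [real_inner_comm] at h4
    have := mul_le_mul_of_nonneg_left h4 (sub_nonneg.2 hθ1)
    rw [real_inner_comm] at this
    nlinarith [real_inner_comm e d]
  by_contra hlt
  push Not at hlt
  have h6 : 0 < (‖e‖ - ‖d‖) * ((1 - θ) * ‖e‖ + θ * ‖d‖) := by
    have := norm_nonneg d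
    apply mul_pos (by linarith)
    have : 0 < ‖e‖ := by linarith
    have : 0 < (1 - θ) * ‖e‖ := mul_pos (by linarith) this
    positivity
  nlinarith

/-- Quadratic growth of `u' ↦ moreau h μ u' + (β / 2) ‖u' - b‖²` away from its minimizer. -/
theorem growth {L : ℝ≥0} (hh : LipschitzWith L h) (hW : 0 ≤ W) (hμ : 0 < μ)
    (hWμ : 2 * (W * μ) ≤ 1) {β : ℝ} {b : E} (hp : ProxPair h W μ u y w)
    (hb : w = β • (b - y)) (y' : E) :
    moreau h μ y + β / 2 * ‖y - b‖ ^ 2 + (β / 2 - W) * ‖y' - y‖ ^ 2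
      ≤ moreau h μ y' + β / 2 * ‖y' - b‖ ^ 2 := by
  rw [hp.moreau_eq hh hμ (by linarith [mul_nonneg hW hμ.le])]
  rw [← sub_le_iff_le_add]
  refine le_ciInf fun v => ?_
  unfold proxObj
  have h1 := hp.sub v
  have e1 : v - y' = ((v - u) - (y' - y)) - μ • w := by rw [← hp.eq]; abel
  have e2 : y' - b = (y' - y) - (b - y) := by abel
  set p := v - u
  set q := y' - y
  have e3 : ‖y - b‖ ^ 2 = ‖b - y‖ ^ 2 := by rw [← norm_neg, neg_sub]
  have e4 : ‖v - y'‖ ^ 2 = ‖p - q‖ ^ 2 - 2 * μ * inner ℝ w (p - q) + μ ^ 2 * ‖w‖ ^ 2 := by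
    rw [e1, norm_sub_sq_real (p - q), inner_smul_right, norm_smul, mul_pow, Real.norm_eq_abs,
      sq_abs, real_inner_comm]; ring
  have e5 : β / 2 * ‖y' - b‖ ^ 2 = β / 2 * ‖q‖ ^ 2 - inner ℝ w q + β / 2 * ‖b - y‖ ^ 2 := by
    rw [e2, norm_sub_sq_real, hb, inner_smul_left, real_inner_comm]
    simp only [conj_trivial]; ring
  have e6 : 1 / (2 * μ) * ‖v - y'‖ ^ 2
      = 1 / (2 * μ) * ‖p - q‖ ^ 2 - inner ℝ w (p - q) + μ / 2 * ‖w‖ ^ 2 := by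
    rw [e4]; field_simp
  have h7 : ‖p‖ ^ 2 ≤ 2 * ‖p - q‖ ^ 2 + 2 * ‖q‖ ^ 2 := by
    have h := norm_add_le (p - q) q
    rw [sub_add_cancel] at h
    have := pow_le_pow_left₀ (norm_nonneg p) h 2
    nlinarith [sq_nonneg (‖p - q‖ - ‖q‖)]
  have h8 : W * ‖p - q‖ ^ 2 ≤ 1 / (2 * μ) * ‖p - q‖ ^ 2 := by
    apply mul_le_mul_of_nonneg_right _ (by positivity)
    rw [le_div_iff₀ (by positivity)]; linarith
  have h9 : W / 2 * ‖p‖ ^ 2 ≤ W / 2 * (2 * ‖p - q‖ ^ 2 + 2 * ‖q‖ ^ 2) := by gcongr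
  have e7 : inner ℝ w (p - q) = inner ℝ w p - inner ℝ w q := inner_sub_right w p q
  rw [e5, e6, e3, e7]
  linarith

end ProxPair

/-- The two minimizations that define `y` and the auxiliary point `u` are consistent: `u` is the
proximal point of `y`, and the gradient of the Moreau envelope at `y` is `β (b - y)`. -/
theorem proxPair_of_isMinOn {h : E → ℝ} {L : ℝ≥0} (hh : LipschitzWith L h) {W : ℝ} (hW : 0 ≤ W)
    (hc : ConvexOn ℝ univ fun y => h y + W / 2 * ‖y‖ ^ 2) {μ β : ℝ} (hμ : 0 < μ)
    (hβ : 0 < β) (hWμ : 2 * (W * μ) ≤ 1) (hWβ : 2 * W < β) {b u y : E}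
    (hu : IsProx h (μ + 1 / β) b u)
    (hy : IsMinOn (fun v => moreau h μ v + β / 2 * ‖v - b‖ ^ 2) univ y) :
    ProxPair h W μ u y (β • (b - y)) := by
  set w := (1 / (μ + 1 / β)) • (b - u) with hw
  set y₁ := u + μ • w with hy₁
  have hp : ProxPair h W μ u y₁ w := ⟨by simp [hy₁], hu.weakSubgradient hc⟩
  have hwb : w = β • (b - y₁) := by
    have : b - u = (μ + 1 / β) • w := by
      rw [hw, smul_smul, mul_one_div_cancel (by positivity), one_smul]
    have h2 : b - y₁ = (1 / β) • w := by
      have : b - y₁ = (b - u) - μ • w := by rw [hy₁]; abel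
      rw [this, ‹b - u = _›]; module
    rw [h2, smul_smul, mul_one_div_cancel hβ.ne', one_smul]
  have h1 := hp.growth hh hW hμ hWμ hwb y
  have h2 : moreau h μ y + β / 2 * ‖y - b‖ ^ 2 ≤ moreau h μ y₁ + β / 2 * ‖y₁ - b‖ ^ 2 :=
    hy (mem_univ y₁)
  have h3 : ‖y - y₁‖ ^ 2 ≤ 0 := by
    by_contra hlt
    push Not at hlt
    have := mul_pos (show 0 < β / 2 - W by linarith) hlt
    linarith
  have h4 : y = y₁ := by
    have : ‖y - y₁‖ = 0 := by nlinarith [norm_nonneg (y - y₁)]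
    exact sub_eq_zero.1 (norm_eq_zero.1 this)
  rw [h4, ← hwb]
  exact hp

end Nonsmooth

/-! ### The Frobenius inner product and the geometry of the Stiefel manifold -/

section Matrices

variable {n r : ℕ}

@[simp] theorem toMatrix_ofMatrix (M : Matrix (Fin n) (Fin r) ℝ) :
    (Mat.ofMatrix M).toMatrix = M := rfl

@[simp] theorem ofMatrix_toMatrix (X : Mat n r) : Mat.ofMatrix X.toMatrix = X := rfl

@[simp] theorem toMatrix_add (X Y : Mat n r) :
    (X + Y).toMatrix = X.toMatrix + Y.toMatrix := rfl

@[simp] theorem toMatrix_sub (X Y : Mat n r) :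
    (X - Y).toMatrix = X.toMatrix - Y.toMatrix := rfl

@[simp] theorem toMatrix_smul (c : ℝ) (X : Mat n r) :
    (c • X).toMatrix = c • X.toMatrix := rfl

@[simp] theorem toMatrix_zero : (0 : Mat n r).toMatrix = 0 := rfl

theorem toMatrix_injective : Function.Injective (Mat.toMatrix : Mat n r → _) := fun X Y h => by
  rw [← ofMatrix_toMatrix X, h, ofMatrix_toMatrix]

theorem continuous_toMatrix : Continuous (Mat.toMatrix : Mat n r → _) :=
  continuous_matrix fun i j => by
    simp only [Mat.toMatrix, Matrix.of_apply]; fun_prop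

theorem inner_eq_trace (X Y : Mat n r) :
    inner ℝ X Y = (X.toMatrixᵀ * Y.toMatrix).trace := by
  simp only [Matrix.trace, Matrix.diag, Matrix.mul_apply, Matrix.transpose_apply, Mat.toMatrix,
    Matrix.of_apply, PiLp.inner_apply, RCLike.inner_apply, conj_trivial]
  rw [Fintype.sum_prod_type, Finset.sum_comm]
  exact Finset.sum_congr rfl fun _ _ => Finset.sum_congr rfl fun _ _ => mul_comm _ _

theorem norm_sq_eq_trace (X : Mat n r) : ‖X‖ ^ 2 = (X.toMatrixᵀ * X.toMatrix).trace := by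
  rw [← inner_eq_trace, real_inner_self_eq_norm_sq]

theorem norm_sq_of_mem_stiefel {X : Mat n r} (hX : X ∈ stiefel n r) : ‖X‖ ^ 2 = r := by
  have hX : X.toMatrixᵀ * X.toMatrix = 1 := hX
  rw [norm_sq_eq_trace, hX]; simp

theorem isCompact_stiefel : IsCompact (stiefel n r) := by
  refine Metric.isCompact_of_isClosed_isBounded ?_ ?_
  · exact isClosed_eq (by
      have := continuous_toMatrix (n := n) (r := r)
      fun_prop) continuous_const
  · refine (Metric.isBounded_closedBall (x := (0 : Mat n r)) (r := Real.sqrt r)).subset ?_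
    intro X hX
    rw [mem_closedBall_zero_iff]
    exact Real.le_sqrt_of_sq_le (norm_sq_of_mem_stiefel hX).le

theorem smul_mem_tangent {X D : Mat n r} (hD : D ∈ tangent X) (c : ℝ) : c • D ∈ tangent X := by
  have hD : X.toMatrixᵀ * D.toMatrix + D.toMatrixᵀ * X.toMatrix = 0 := hD
  change X.toMatrixᵀ * (c • D).toMatrix + (c • D).toMatrixᵀ * X.toMatrix = 0
  rw [toMatrix_smul, Matrix.transpose_smul, Matrix.mul_smul, Matrix.smul_mul, ← smul_add, hD,
    smul_zero]

theorem tangentProj_eq_searchDir (X D : Mat n r) : tangentProj X D = searchDir (1 / 2) X D := by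
  unfold tangentProj searchDir
  congr 1
  rw [Matrix.mul_add, smul_add, ← Matrix.mul_assoc, ← Matrix.mul_assoc]
  module

theorem searchDir_mem_tangent (ρ : ℝ) {X : Mat n r} (hX : X ∈ stiefel n r) (G : Mat n r) :
    searchDir ρ X G ∈ tangent X := by
  have hX : X.toMatrixᵀ * X.toMatrix = 1 := hX
  unfold tangent searchDir
  simp only [mem_ofPred_eq, toMatrix_ofMatrix, Matrix.transpose_sub, Matrix.transpose_smul,
    Matrix.transpose_mul, Matrix.transpose_transpose, Matrix.mul_sub, Matrix.sub_mul,
    Matrix.mul_smul, Matrix.smul_mul, Matrix.mul_assoc, hX, Matrix.mul_one]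
  simp only [← Matrix.mul_assoc, hX, Matrix.one_mul]
  module

/-- The component of `G` normal to the column space of `X`. -/
def normalPart (X G : Mat n r) : Mat n r :=
  Mat.ofMatrix (G.toMatrix - X.toMatrix * X.toMatrixᵀ * G.toMatrix)

/-- The tangent vector `X (Xᵀ G - Gᵀ X)`. -/
def skewPart (X G : Mat n r) : Mat n r :=
  Mat.ofMatrix (X.toMatrix * X.toMatrixᵀ * G.toMatrix - X.toMatrix * G.toMatrixᵀ * X.toMatrix)

theorem searchDir_eq (ρ : ℝ) (X G : Mat n r) :
    searchDir ρ X G = normalPart X G + ρ • skewPart X G := by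
  apply toMatrix_injective
  simp only [searchDir, normalPart, skewPart, toMatrix_add, toMatrix_smul, toMatrix_ofMatrix]
  module

theorem inner_normalPart_skewPart {X : Mat n r} (hX : X ∈ stiefel n r) (G : Mat n r) :
    inner ℝ (normalPart X G) (skewPart X G) = 0 := by
  have hX : X.toMatrixᵀ * X.toMatrix = 1 := hX
  rw [inner_eq_trace]
  simp only [normalPart, skewPart, toMatrix_ofMatrix, Matrix.transpose_sub, Matrix.transpose_mul,
    Matrix.transpose_transpose, Matrix.mul_sub, Matrix.sub_mul, Matrix.mul_assoc]
  simp only [← Matrix.mul_assoc X.toMatrixᵀ X.toMatrix, hX, Matrix.one_mul, sub_self, Matrix.trace_zero]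

theorem inner_normalPart_right {X : Mat n r} (hX : X ∈ stiefel n r) (G : Mat n r) :
    inner ℝ G (normalPart X G) = ‖normalPart X G‖ ^ 2 := by
  have hX : X.toMatrixᵀ * X.toMatrix = 1 := hX
  rw [norm_sq_eq_trace, inner_eq_trace]
  simp only [normalPart, toMatrix_ofMatrix, Matrix.transpose_sub, Matrix.transpose_mul,
    Matrix.transpose_transpose, Matrix.mul_sub, Matrix.sub_mul, Matrix.mul_assoc]
  simp only [← Matrix.mul_assoc X.toMatrixᵀ X.toMatrix, hX, Matrix.one_mul, sub_self, sub_zero]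

theorem inner_skewPart_right {X : Mat n r} (hX : X ∈ stiefel n r) (G : Mat n r) :
    inner ℝ G (skewPart X G) = ‖skewPart X G‖ ^ 2 / 2 := by
  have hX : X.toMatrixᵀ * X.toMatrix = 1 := hX
  rw [norm_sq_eq_trace, inner_eq_trace]
  simp only [skewPart, toMatrix_ofMatrix, Matrix.transpose_sub, Matrix.transpose_mul,
    Matrix.transpose_transpose, Matrix.mul_sub, Matrix.sub_mul, Matrix.mul_assoc]
  simp only [← Matrix.mul_assoc X.toMatrixᵀ X.toMatrix, hX, Matrix.one_mul, Matrix.trace_sub]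
  -- with `K = Xᵀ G` the four traces are those of `Kᵀ K`, `Kᵀ Kᵀ`, `K K` and `K Kᵀ`
  have h1 : (X.toMatrixᵀ * (G.toMatrix * (X.toMatrixᵀ * G.toMatrix))).trace
      = (G.toMatrixᵀ * (X.toMatrix * (G.toMatrixᵀ * X.toMatrix))).trace := by
    rw [← Matrix.trace_transpose]
    simp only [Matrix.transpose_mul, Matrix.transpose_transpose, Matrix.mul_assoc]
  have h2 : (X.toMatrixᵀ * (G.toMatrix * (G.toMatrixᵀ * X.toMatrix))).trace
      = (G.toMatrixᵀ * (X.toMatrix * (X.toMatrixᵀ * G.toMatrix))).trace := by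
    rw [← Matrix.mul_assoc, Matrix.trace_mul_comm, Matrix.mul_assoc]
  rw [h1, h2]; ring

/-- The search direction is a direction of descent for the linearization `G`. -/
theorem norm_searchDir_sq_le {ρ : ℝ} (hρ : 0 < ρ) {X : Mat n r} (hX : X ∈ stiefel n r)
    (G : Mat n r) :
    1 / max 1 (2 * ρ) * ‖searchDir ρ X G‖ ^ 2 ≤ inner ℝ G (searchDir ρ X G) := by
  have e1 : ‖searchDir ρ X G‖ ^ 2 = ‖normalPart X G‖ ^ 2 + ρ ^ 2 * ‖skewPart X G‖ ^ 2 := by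
    rw [searchDir_eq, norm_add_sq_real, inner_smul_right, inner_normalPart_skewPart hX, norm_smul,
      mul_pow, Real.norm_eq_abs, sq_abs]; ring
  have e2 : inner ℝ G (searchDir ρ X G) = ‖normalPart X G‖ ^ 2 + ρ / 2 * ‖skewPart X G‖ ^ 2 := by
    rw [searchDir_eq, inner_add_right, inner_smul_right, inner_normalPart_right hX,
      inner_skewPart_right hX]; ring
  have hm1 : 1 ≤ max 1 (2 * ρ) := le_max_left _ _
  have hm2 : 2 * ρ ≤ max 1 (2 * ρ) := le_max_right _ _
  rw [e1, e2, one_div_mul_eq_div, div_le_iff₀ (by linarith)]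
  set p := ‖normalPart X G‖ ^ 2
  set q := ‖skewPart X G‖ ^ 2
  have hp : 0 ≤ p := by positivity
  have hq : 0 ≤ q := by positivity
  have h1 := mul_le_mul_of_nonneg_left hm1 hp
  have h2 := mul_le_mul_of_nonneg_left hm2 (mul_nonneg hρ.le hq)
  linarith

theorem norm_searchDir_le {ρ : ℝ} (hρ : 0 < ρ) {X : Mat n r} (hX : X ∈ stiefel n r)
    (G : Mat n r) : ‖searchDir ρ X G‖ ≤ max 1 (2 * ρ) * ‖G‖ := by
  have h1 := (norm_searchDir_sq_le hρ hX G).trans (real_inner_le_norm _ _)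
  have hm1 : (0 : ℝ) < max 1 (2 * ρ) := lt_max_of_lt_left one_pos
  rw [one_div_mul_eq_div, div_le_iff₀ hm1] at h1
  by_contra hlt
  push Not at hlt
  have h2 : 0 < ‖searchDir ρ X G‖ := lt_of_le_of_lt (by positivity) hlt
  nlinarith

theorem norm_tangentProj_le {X : Mat n r} (hX : X ∈ stiefel n r) (D : Mat n r) :
    ‖tangentProj X D‖ ≤ ‖D‖ := by
  rw [tangentProj_eq_searchDir]
  simpa using norm_searchDir_le (ρ := 1 / 2) (by norm_num) hX D

theorem norm_tangentProj_le_searchDir {ρ : ℝ} (hρ : 0 < ρ) {X : Mat n r} (hX : X ∈ stiefel n r)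
    (G : Mat n r) : ‖tangentProj X G‖ ≤ (1 + 1 / ρ) * ‖searchDir ρ X G‖ := by
  have e1 : ∀ c : ℝ, ‖searchDir c X G‖ ^ 2
      = ‖normalPart X G‖ ^ 2 + c ^ 2 * ‖skewPart X G‖ ^ 2 := fun c => by
    rw [searchDir_eq, norm_add_sq_real, inner_smul_right, inner_normalPart_skewPart hX, norm_smul,
      mul_pow, Real.norm_eq_abs, sq_abs]; ring
  rw [tangentProj_eq_searchDir]
  refine le_of_sq_le_sq ?_ (by positivity)
  rw [mul_pow, e1, e1]
  set p := ‖normalPart X G‖ ^ 2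
  set q := ‖skewPart X G‖ ^ 2
  have hp : 0 ≤ p := by positivity
  have hq : 0 ≤ q := by positivity
  have h1 : (1 + 1 / ρ) ^ 2 * (p + ρ ^ 2 * q)
      = p + q + (2 * (1 / ρ) + (1 / ρ) ^ 2) * p + (ρ ^ 2 + 2 * ρ) * q := by field_simp; ring
  rw [h1]
  have h2 : 0 ≤ (2 * (1 / ρ) + (1 / ρ) ^ 2) * p := by positivity
  have h3 : 0 ≤ (ρ ^ 2 + 2 * ρ) * q := by positivity
  linarith

theorem tangentProj_sub (X D E : Mat n r) :
    tangentProj X (D - E) = tangentProj X D - tangentProj X E := by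
  apply toMatrix_injective
  simp only [tangentProj, toMatrix_sub, toMatrix_ofMatrix, Matrix.transpose_sub, Matrix.mul_sub,
    Matrix.sub_mul, Matrix.mul_add]
  module

end Matrices

/-! ### Second-order estimate for a retraction -/

section Retraction

variable {n r : ℕ}

/-- A `C²` function on a set that contains, near `q₀`, the segments from `(X, 0)` to its points
`(X, D)`, satisfies a uniform second-order Taylor estimate along these segments. The set need not
have unique derivatives: `φ X` is one choice of derivative at `(X, 0)` in the direction of `D`. -/
theorem exists_taylor_bound_of_contDiffWithinAt {E F : Type*} [NormedAddCommGroup E]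
    [NormedSpace ℝ E] [NormedAddCommGroup F] [NormedSpace ℝ F] {R : E → E → F} {S : Set (E × E)}
    {X₀ : E} (hS : ∀ X D : E, (X, D) ∈ S → ∀ t : ℝ, (X, t • D) ∈ S) (hX₀ : (X₀, (0 : E)) ∈ S)
    (hR : ContDiffWithinAt ℝ 2 (fun q : E × E => R q.1 q.2) S (X₀, 0)) :
    ∃ δ > 0, ∃ M : ℝ, 0 ≤ M ∧ ∃ φ : E → E →L[ℝ] F, ∀ X D : E, (X, D) ∈ S → ‖X - X₀‖ < δ →
      ‖D‖ < δ → ‖R X D - R X 0 - φ X D‖ ≤ M * ‖D‖ ^ 2 := by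
  have h2 : (2 : WithTop ℕ∞) = 1 + 1 := by norm_num
  rw [h2, contDiffWithinAt_succ_iff_hasFDerivWithinAt' (by simp)] at hR
  obtain ⟨u, hu, -, -, f', hf', hf'1⟩ := hR
  have h1 : (1 : WithTop ℕ∞) = 0 + 1 := by norm_num
  rw [h1, contDiffWithinAt_succ_iff_hasFDerivWithinAt' (by simp)] at hf'1
  obtain ⟨u', hu', -, -, f'', hf'', hf''0⟩ := hf'1
  rw [insert_eq_of_mem hX₀] at hu hu'
  have hcont : ∀ᶠ q in 𝓝[S] (X₀, (0 : E)), ‖f'' q‖ < ‖f'' (X₀, 0)‖ + 1 :=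
    hf''0.continuousWithinAt.norm.eventually (gt_mem_nhds (by linarith))
  obtain ⟨δ, hδ, hball⟩ := Metric.mem_nhdsWithin_iff.1
    (Filter.inter_mem (Filter.inter_mem hu hu') hcont)
  set M := ‖f'' (X₀, 0)‖ + 1
  refine ⟨δ, hδ, M, by positivity, fun X => (f' (X, 0)).comp (ContinuousLinearMap.inr ℝ E E), ?_⟩
  intro X D hXD hX hD
  set T : Set (E × E) := (fun t : ℝ => (X, t • D)) '' Icc 0 1 with hT
  have hTS : T ⊆ Metric.ball (X₀, (0 : E)) δ ∩ S := by
    rintro _ ⟨t, ht, rfl⟩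
    refine ⟨?_, hS X D hXD t⟩
    rw [mem_ball_iff_norm, Prod.mk_sub_mk, Prod.norm_mk, sub_zero, max_lt_iff, norm_smul,
      Real.norm_eq_abs, abs_of_nonneg ht.1]
    exact ⟨hX, lt_of_le_of_lt (mul_le_of_le_one_left (norm_nonneg _) ht.2) hD⟩
  have hTconv : Convex ℝ T := by
    rintro _ ⟨s, hs, rfl⟩ _ ⟨t, ht, rfl⟩ a b ha hb hab
    refine ⟨a * s + b * t, ⟨?_, ?_⟩, ?_⟩
    · have := hs.1; have := ht.1; positivity
    · nlinarith [hs.2, ht.2]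
    · ext
      · change X = a • X + b • X
        rw [← add_smul, hab, one_smul]
      · change (a * s + b * t) • D = a • s • D + b • t • D
        module
  have hT0 : (X, (0 : E)) ∈ T := ⟨0, by simp, by simp⟩
  have hT1 : (X, D) ∈ T := ⟨1, by simp, by simp⟩
  have hbound' : ∀ q ∈ T, ‖f' q - f' (X, 0)‖ ≤ M * ‖D‖ := by
    rintro q hq
    refine (hTconv.norm_image_sub_le_of_norm_hasFDerivWithin_le (C := M)
      (fun x hx => (hf'' x (hball (hTS hx)).1.2).mono (hTS.trans inter_subset_right))
      (fun x hx => (show ‖f'' x‖ < M from (hball (hTS hx)).2).le) hT0 hq).trans ?_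
    obtain ⟨t, ht, rfl⟩ := hq
    rw [Prod.mk_sub_mk, Prod.norm_mk, sub_self, sub_zero, norm_zero, norm_smul,
      Real.norm_eq_abs, abs_of_nonneg ht.1, max_eq_right (by have := ht.1; positivity)]
    gcongr
    exact mul_le_of_le_one_left (norm_nonneg _) ht.2
  have := hTconv.norm_image_sub_le_of_norm_hasFDerivWithin_le'
    (fun x hx => (hf' x (hball (hTS hx)).1.1).mono (hTS.trans inter_subset_right))
    hbound' hT0 hT1
  rw [Prod.mk_sub_mk, Prod.norm_mk, sub_self, sub_zero, norm_zero,
    max_eq_right (norm_nonneg _)] at this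
  calc _ ≤ M * ‖D‖ * ‖D‖ := this
    _ = _ := by ring

theorem zero_mem_tangent (X : Mat n r) : (0 : Mat n r) ∈ tangent X := by
  change X.toMatrixᵀ * (0 : Mat n r).toMatrix + (0 : Mat n r).toMatrixᵀ * X.toMatrix = 0
  simp

/-- If `R X D` agrees with `X + φ D` up to `O(‖D‖²)`, the first-order condition on the retraction
forces `φ D = D` for tangent vectors `D`. -/
theorem IsRetraction.eq_of_taylor {R : Mat n r → Mat n r → Mat n r} (hR : IsRetraction R)
    {X : Mat n r} (hX : X ∈ stiefel n r) {φ : Mat n r →L[ℝ] Mat n r} {M δ : ℝ} (hδ : 0 < δ)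
    (hφ : ∀ D ∈ tangent X, ‖D‖ < δ → ‖R X D - X - φ D‖ ≤ M * ‖D‖ ^ 2) {D : Mat n r}
    (hD : D ∈ tangent X) : φ D = D := by
  by_cases hD0 : D = 0
  · rw [hD0, map_zero]
  have hDpos : 0 < ‖D‖ := norm_pos_iff.2 hD0
  have hray : Tendsto (fun s : ℝ => s • D) (𝓝[>] 0) (𝓝[tangent X \ {0}] 0) := by
    refine tendsto_nhdsWithin_iff.2 ⟨?_, ?_⟩
    · have : Continuous fun s : ℝ => s • D := by fun_prop
      simpa using (this.tendsto 0).mono_left nhdsWithin_le_nhds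
    · filter_upwards [self_mem_nhdsWithin] with s hs
      exact ⟨smul_mem_tangent hD s, by
        simpa using ⟨(show (0 : ℝ) < s from hs).ne', hD0⟩⟩
  have hlim := (hR.first_order X hX).comp hray
  have hlim2 : Tendsto (fun s : ℝ => ‖R X (s • D) - X - s • D‖ / ‖s • D‖ * ‖D‖ + s * (M * ‖D‖ ^ 2))
      (𝓝[>] 0) (𝓝 0) := by
    have h3 : Tendsto (fun s : ℝ => s * (M * ‖D‖ ^ 2)) (𝓝[>] 0) (𝓝 0) := by
      have : Continuous fun s : ℝ => s * (M * ‖D‖ ^ 2) := by fun_prop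
      simpa using (this.tendsto 0).mono_left nhdsWithin_le_nhds
    simpa using (hlim.mul_const ‖D‖).add h3
  have hle : ‖φ D - D‖ ≤ 0 := by
    refine ge_of_tendsto hlim2 ?_
    filter_upwards [Ioo_mem_nhdsGT (show 0 < δ / ‖D‖ by positivity)] with s hs
    have hs0 := hs.1
    have hsn : ‖s • D‖ = s * ‖D‖ := by rw [norm_smul, Real.norm_eq_abs, abs_of_pos hs0]
    have h1 := hφ (s • D) (smul_mem_tangent hD s) (by
      rw [hsn]; exact (lt_div_iff₀ hDpos).1 hs.2)
    have h2 : s * ‖φ D - D‖ ≤ ‖R X (s • D) - X - s • D‖ + M * (s * ‖D‖) ^ 2 := by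
      rw [← hsn]
      calc s * ‖φ D - D‖ = ‖s • (φ D - D)‖ := by
            rw [norm_smul, Real.norm_eq_abs, abs_of_pos hs0]
        _ = ‖(R X (s • D) - X - s • D) - (R X (s • D) - X - φ (s • D))‖ := by
            congr 1; rw [map_smul]; module
        _ ≤ _ := (norm_sub_le _ _).trans (by gcongr)
    rw [hsn]
    have h3 : ‖R X (s • D) - X - s • D‖ / (s * ‖D‖) * ‖D‖ + s * (M * ‖D‖ ^ 2)
        = (‖R X (s • D) - X - s • D‖ + M * (s * ‖D‖) ^ 2) / s := by
      field_simp
    rw [h3, le_div_iff₀ hs0]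
    linarith
  exact sub_eq_zero.1 (norm_le_zero_iff.1 hle)

/-- By compactness of the manifold, `R X D = X + D + O(‖D‖²)` uniformly in `X`. -/
theorem IsRetraction.exists_second_order_bound {R : Mat n r → Mat n r → Mat n r}
    (hR : IsRetraction R) : ∃ δ > 0, ∃ M : ℝ, 0 ≤ M ∧ ∀ X ∈ stiefel n r, ∀ D ∈ tangent X,
      ‖D‖ < δ → ‖R X D - X - D‖ ≤ M * ‖D‖ ^ 2 := by
  -- membership in the manifold is repeated so that the inner statement can be localized to
  -- neighborhoods in the ambient space
  have key : ∃ δ > 0, ∃ M : ℝ, 0 ≤ M ∧ ∀ X ∈ stiefel n r, X ∈ stiefel n r → ∀ D ∈ tangent X,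
      ‖D‖ < δ → ‖R X D - X - D‖ ≤ M * ‖D‖ ^ 2 := by
    refine isCompact_stiefel.induction_on (p := fun S : Set (Mat n r) => ∃ δ > 0, ∃ M : ℝ, 0 ≤ M ∧
      ∀ X ∈ S, X ∈ stiefel n r → ∀ D ∈ tangent X, ‖D‖ < δ → ‖R X D - X - D‖ ≤ M * ‖D‖ ^ 2)
      ⟨1, one_pos, 0, le_rfl, by simp⟩ ?_ ?_ ?_
    · rintro S T hST ⟨δ, hδ, M, hM, h⟩
      exact ⟨δ, hδ, M, hM, fun X hX => h X (hST hX)⟩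
    · rintro S T ⟨δ, hδ, M, hM, h⟩ ⟨δ', hδ', M', hM', h'⟩
      refine ⟨min δ δ', lt_min hδ hδ', max M M', le_max_of_le_left hM, ?_⟩
      rintro X (hX | hX) hXS D hD hDδ
      · refine (h X hX hXS D hD (hDδ.trans_le (min_le_left _ _))).trans ?_
        gcongr; exact le_max_left _ _
      · refine (h' X hX hXS D hD (hDδ.trans_le (min_le_right _ _))).trans ?_
        gcongr; exact le_max_right _ _
    · intro X₀ hX₀
      obtain ⟨δ, hδ, M, hM, φ, h⟩ := exists_taylor_bound_of_contDiffWithinAt (X₀ := X₀)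
        (S := {q : Mat n r × Mat n r | q.1 ∈ stiefel n r ∧ q.2 ∈ tangent q.1})
        (fun X D hXD t => ⟨hXD.1, smul_mem_tangent hXD.2 t⟩) ⟨hX₀, zero_mem_tangent X₀⟩
        (contDiffOn_infty.1 hR.smooth 2 (X₀, 0) ⟨hX₀, zero_mem_tangent X₀⟩)
      refine ⟨Metric.ball X₀ δ, mem_nhdsWithin_of_mem_nhds (Metric.ball_mem_nhds X₀ hδ), δ, hδ, M,
        hM, fun X hX hXS D hD hDδ => ?_⟩
      rw [mem_ball_iff_norm] at hX
      have h' : ∀ D ∈ tangent X, ‖D‖ < δ → ‖R X D - X - φ X D‖ ≤ M * ‖D‖ ^ 2 := fun D hD hDδ => by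
        simpa only [hR.zero X hXS] using h X D ⟨hXS, hD⟩ hX hDδ
      have := h' D hD hDδ
      rwa [hR.eq_of_taylor hXS hδ h' hD] at this
  obtain ⟨δ, hδ, M, hM, h⟩ := key
  exact ⟨δ, hδ, M, hM, fun X hX => h X hX hX⟩

end Retraction

/-! ### The smooth part of the augmented Lagrangian and the line search -/

section LineSearch

variable {n r m : ℕ} {P : Problem n r m} {Lf Cg Ch : ℝ≥0} {Wh : ℝ}

theorem gradient_smoothPart_left (hf : Differentiable ℝ P.f) (X : Mat n r) (y z : Vec m) (β : ℝ) :
    gradient (fun X' => P.smoothPart X' y z β) X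
      = gradient P.f X + ContinuousLinearMap.adjoint P.A (z + β • (P.A X - y)) := by
  apply HasGradientAt.gradient
  rw [hasGradientAt_iff_hasFDerivAt]
  have hA : HasFDerivAt (fun X' => P.A X' - y) P.A X := P.A.hasFDerivAt.sub_const y
  have h1 := ((hf X).hasGradientAt.hasFDerivAt.add ((hasFDerivAt_const z X).inner ℝ hA)).add
    (hA.norm_sq.const_mul (β / 2))
  refine h1.congr_fderiv ?_
  ext D
  simp [ContinuousLinearMap.adjoint_inner_left]
  ring

theorem gradient_smoothPart_right (X : Mat n r) (y z : Vec m) (β : ℝ) :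
    gradient (fun y' => P.smoothPart X y' z β) y = -(z + β • (P.A X - y)) := by
  apply HasGradientAt.gradient
  rw [hasGradientAt_iff_hasFDerivAt]
  have hA : HasFDerivAt (fun y' => P.A X - y') (-ContinuousLinearMap.id ℝ (Vec m)) y :=
    (hasFDerivAt_id y).const_sub (P.A X)
  have h1 := ((hasFDerivAt_const (P.f X) y).add ((hasFDerivAt_const z y).inner ℝ hA)).add
    (hA.norm_sq.const_mul (β / 2))
  refine h1.congr_fderiv ?_
  ext D
  simp
  ring

theorem Problem.Assumptions.f_le (hP : P.Assumptions Lf Cg Ch Wh) (X X' : Mat n r) :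
    P.f X' ≤ P.f X + inner ℝ (gradient P.f X) (X' - X) + Lf * ‖X' - X‖ ^ 2 := by
  have h := (convex_segment X X').norm_image_sub_le_of_norm_hasFDerivWithin_le' (𝕜 := ℝ)
    (f := P.f) (f' := fun x => InnerProductSpace.toDual ℝ _ (gradient P.f x))
    (φ := InnerProductSpace.toDual ℝ _ (gradient P.f X)) (C := Lf * ‖X' - X‖)
    (fun x _ => (hP.f_diff x).hasGradientAt.hasFDerivAt.hasFDerivWithinAt) (fun x hx => by
      rw [← map_sub, LinearIsometryEquiv.norm_map]
      refine (hP.f_smooth.norm_sub_le x X).trans ?_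
      gcongr
      rw [segment_eq_image'] at hx
      obtain ⟨t, ht, rfl⟩ := hx
      rw [add_sub_cancel_left, norm_smul, Real.norm_eq_abs, abs_of_nonneg ht.1]
      exact mul_le_of_le_one_left (norm_nonneg _) ht.2)
    (left_mem_segment ℝ X X') (right_mem_segment ℝ X X')
  rw [Real.norm_eq_abs, InnerProductSpace.toDual_apply_apply] at h
  have := (abs_le.1 h).2
  nlinarith

/-- The descent lemma for the smooth part of the augmented Lagrangian. -/
theorem Problem.Assumptions.smoothPart_le (hP : P.Assumptions Lf Cg Ch Wh) {β : ℝ} (hβ : 0 ≤ β)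
    (X X' : Mat n r) (y z : Vec m) :
    P.smoothPart X' y z β ≤ P.smoothPart X y z β
      + inner ℝ (gradient (fun X' => P.smoothPart X' y z β) X) (X' - X)
      + (Lf + β * ‖P.A‖ ^ 2) * ‖X' - X‖ ^ 2 := by
  have h1 := hP.f_le X X'
  rw [gradient_smoothPart_left hP.f_diff]
  unfold Problem.smoothPart
  have e1 : P.A X' - y = (P.A X - y) + P.A (X' - X) := by rw [map_sub]; abel
  rw [e1, norm_add_sq_real, inner_add_right, inner_add_left (𝕜 := ℝ) (gradient P.f X),
    ContinuousLinearMap.adjoint_inner_left, inner_add_left (𝕜 := ℝ) z, inner_smul_left]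
  simp only [conj_trivial]
  have h2 : ‖P.A (X' - X)‖ ^ 2 ≤ ‖P.A‖ ^ 2 * ‖X' - X‖ ^ 2 := by
    rw [← mul_pow]
    exact pow_le_pow_left₀ (norm_nonneg _) (P.A.le_opNorm _) 2
  have h3 := mul_le_mul_of_nonneg_left h2 hβ
  have h4 : 0 ≤ β * ‖P.A (X' - X)‖ ^ 2 := by positivity
  nlinarith

/-- One trial number works for all points, multipliers and penalties with bounded linearization:
the linear decrease dominates the second-order terms, which are `O(η² (1 + β) ‖D‖²)` for the
stepsize `η = b γ ^ J / β`. -/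
theorem exists_lineSearchTest (hP : P.Assumptions Lf Cg Ch Wh)
    {R : Mat n r → Mat n r → Mat n r} (hR : IsRetraction R) {a : Params} (ha : a.Valid Wh)
    {B : ℝ} (hB : 0 ≤ B) :
    ∃ J : ℕ, ∀ (β : ℝ) (X : Mat n r) (y z : Vec m) (v : Mat n r) (b : ℝ), a.β₀ ≤ β →
      X ∈ stiefel n r → v ∈ limitingSubdiff P.g X →
      ‖gradient (fun X' => P.smoothPart X' y z β) X - v‖ ≤ B → b ∈ Ioo a.bLow a.bHigh →
      P.LineSearchTest R a β X y z (P.direction a.ρ β X y z v) (b * a.γ ^ J / β) := by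
  obtain ⟨δ, hδ, M, hM, hsec⟩ := hR.exists_second_order_bound
  set k := max 1 (2 * a.ρ) with hk
  have hk0 : 0 < k := lt_max_of_lt_left one_pos
  have hβ₀ := ha.β₀_pos
  have hbH : 0 < a.bHigh := ha.bLow_pos.trans ha.bLow_lt
  set c := (1 + M * δ) ^ 2 with hc
  set Q := (B * M + Lf * c) / a.β₀ + ‖P.A‖ ^ 2 * c with hQ
  have hc0 : 0 ≤ c := by positivity
  have hQ0 : 0 ≤ Q := by positivity
  have hκ : 0 < 1 / k - a.δ := sub_pos.2 ha.δ_lt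
  obtain ⟨J, hJ⟩ := exists_pow_lt_of_lt_one (show 0 < min ((1 / k - a.δ) / (a.bHigh * (Q + 1)))
    (δ / (a.bHigh * (k * B / a.β₀ + 1))) by positivity) ha.γ_lt
  refine ⟨J, fun β X y z v b hβ hX hv hG hb => ?_⟩
  have hβ0 : 0 < β := hβ₀.trans_le hβ
  have hb0 : 0 < b := ha.bLow_pos.trans hb.1
  have hγJ : 0 < a.γ ^ J := pow_pos ha.γ_pos J
  set G := gradient (fun X' => P.smoothPart X' y z β) X - v with hGdef
  have hDdef : P.direction a.ρ β X y z v = searchDir a.ρ X G := rfl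
  unfold Problem.LineSearchTest
  rw [hDdef]
  set D := searchDir a.ρ X G with hD
  set η := b * a.γ ^ J / β with hη
  have hη0 : 0 < η := by positivity
  set ε := a.bHigh * a.γ ^ J with hε
  have hηβ : η * β ≤ ε := by
    rw [hη, div_mul_cancel₀ _ hβ0.ne', hε]
    gcongr
    exact hb.2.le
  have hηε : η ≤ ε / a.β₀ := by
    rw [le_div_iff₀ hβ₀]
    exact (mul_le_mul_of_nonneg_left hβ hη0.le).trans hηβ
  have hεQ : ε * Q ≤ 1 / k - a.δ := by
    have := (hJ.trans_le (min_le_left _ _)).le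
    rw [le_div_iff₀ (by positivity)] at this
    have h' : 0 ≤ ε := by positivity
    calc ε * Q ≤ ε * (Q + 1) := by gcongr; linarith
      _ = a.γ ^ J * (a.bHigh * (Q + 1)) := by rw [hε]; ring
      _ ≤ _ := this
  have hDle : ‖D‖ ≤ k * B := (norm_searchDir_le ha.ρ_pos hX G).trans (mul_le_mul_of_nonneg_left hG hk0.le)
  have hηD : η * ‖D‖ < δ := by
    have := hJ.trans_le (min_le_right _ _)
    rw [lt_div_iff₀ (by positivity)] at this
    calc η * ‖D‖ ≤ ε / a.β₀ * (k * B) := by gcongr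
      _ = ε * (k * B / a.β₀) := by ring
      _ ≤ ε * (k * B / a.β₀ + 1) := by gcongr; linarith
      _ = a.γ ^ J * (a.bHigh * (k * B / a.β₀ + 1)) := by rw [hε]; ring
      _ < δ := this
  have hDt : -(η • D) ∈ tangent X := by
    rw [← neg_smul]
    exact smul_mem_tangent (searchDir_mem_tangent a.ρ hX G) _
  have hDn : ‖-(η • D)‖ = η * ‖D‖ := by
    rw [norm_neg, norm_smul, Real.norm_eq_abs, abs_of_pos hη0]
  have he := hsec X hX _ hDt (by rw [hDn]; exact hηD)
  set X' := R X (-(η • D)) with hX'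
  rw [hDn] at he
  set e := X' - X - -(η • D) with hedef
  have hXX : X' - X = e - η • D := by rw [hedef]; abel
  have hXXn : ‖X' - X‖ ^ 2 ≤ c * (η * ‖D‖) ^ 2 := by
    have h1 : ‖X' - X‖ ≤ (1 + M * δ) * (η * ‖D‖) := by
      calc ‖X' - X‖ ≤ ‖e‖ + ‖η • D‖ := by rw [hXX]; exact norm_sub_le _ _
        _ ≤ M * (η * ‖D‖) ^ 2 + η * ‖D‖ := by
          rw [← norm_neg (η • D), hDn]; gcongr
        _ ≤ M * (δ * (η * ‖D‖)) + η * ‖D‖ := by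
          rw [sq]; gcongr
        _ = _ := by ring
    calc ‖X' - X‖ ^ 2 ≤ ((1 + M * δ) * (η * ‖D‖)) ^ 2 := pow_le_pow_left₀ (norm_nonneg _) h1 2
      _ = _ := by rw [mul_pow]
  have hS := hP.smoothPart_le hβ0.le X X' y z
  have hg := le_sub_of_mem_limitingSubdiff hP.g_convex hv X'
  have hGin : inner ℝ G (X' - X) ≤ -(η * (1 / k * ‖D‖ ^ 2)) + B * (M * (η * ‖D‖) ^ 2) := by
    rw [hXX, inner_sub_right, inner_smul_right]
    have h1 := mul_le_mul_of_nonneg_left (norm_searchDir_sq_le ha.ρ_pos hX G) hη0.le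
    have h2 : inner ℝ G e ≤ B * (M * (η * ‖D‖) ^ 2) :=
      (real_inner_le_norm _ _).trans (by gcongr)
    linarith
  have hGeq : inner ℝ G (X' - X)
      = inner ℝ (gradient (fun X' => P.smoothPart X' y z β) X) (X' - X) - inner ℝ v (X' - X) := by
    rw [hGdef, inner_sub_left]
  have hquad : (Lf + β * ‖P.A‖ ^ 2) * ‖X' - X‖ ^ 2
      ≤ (Lf + β * ‖P.A‖ ^ 2) * (c * (η * ‖D‖) ^ 2) := by gcongr
  have hfin : B * (M * (η * ‖D‖) ^ 2) + (Lf + β * ‖P.A‖ ^ 2) * (c * (η * ‖D‖) ^ 2)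
      ≤ (1 / k - a.δ) * (η * ‖D‖ ^ 2) := by
    calc _ = (η * (B * M + Lf * c) + η * β * (‖P.A‖ ^ 2 * c)) * (η * ‖D‖ ^ 2) := by ring
      _ ≤ (ε / a.β₀ * (B * M + Lf * c) + ε * (‖P.A‖ ^ 2 * c)) * (η * ‖D‖ ^ 2) := by gcongr
      _ = ε * Q * (η * ‖D‖ ^ 2) := by rw [hQ]; ring
      _ ≤ _ := by gcongr
  unfold Problem.lagrangian
  linarith

end LineSearch

/-! ### The penalty sequence -/

section Penalty

variable {a : Params} {Wh : ℝ}

theorem Params.Valid.β_zero (ha : a.Valid Wh) : a.β 0 = a.β₀ := by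
  simp [Params.β, Real.zero_rpow ha.p_pos.ne']

theorem Params.Valid.β_mono (ha : a.Valid Wh) : Monotone a.β := fun s t hst => by
  unfold Params.β
  have := ha.β₀_pos
  have := ha.ξ_pos
  have := ha.p_pos
  gcongr

theorem Params.Valid.β₀_le (ha : a.Valid Wh) (t : ℕ) : a.β₀ ≤ a.β t := by
  rw [← ha.β_zero]; exact ha.β_mono (Nat.zero_le t)

theorem Params.Valid.β_pos (ha : a.Valid Wh) (t : ℕ) : 0 < a.β t := ha.β₀_pos.trans_le (ha.β₀_le t)

theorem Params.Valid.β_succ_le (ha : a.Valid Wh) (t : ℕ) : a.β (t + 1) ≤ (1 + a.ξ) * a.β t := by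
  have h1 : ((t : ℝ) + 1) ^ a.p ≤ (t : ℝ) ^ a.p + 1 := by
    simpa using Real.rpow_add_le_add_rpow (p := a.p) (Nat.cast_nonneg t) zero_le_one ha.p_pos.le
      ha.p_lt.le
  have h2 : 0 ≤ (t : ℝ) ^ a.p := by positivity
  have hξ := ha.ξ_pos
  have h3 : 1 + a.ξ * ((t : ℝ) + 1) ^ a.p ≤ (1 + a.ξ) * (1 + a.ξ * (t : ℝ) ^ a.p) := by
    nlinarith [mul_nonneg hξ.le (mul_nonneg hξ.le h2)]
  unfold Params.β
  push_cast
  nlinarith [mul_le_mul_of_nonneg_left h3 ha.β₀_pos.le]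

theorem Params.Valid.four_le_τ (ha : a.Valid Wh) : 4 ≤ a.τ := by
  refine le_trans ?_ ha.τ_ge
  rw [le_div_iff₀ (by linarith [ha.σ_lt])]
  linarith [ha.one_le_σ]

/-- The weak convexity of `h` is dominated by the penalty. -/
theorem Params.Valid.two_mul_τ_le (ha : a.Valid Wh) (t : ℕ) : 2 * a.τ * Wh ≤ a.β t :=
  ha.β₀_ge.trans (ha.β₀_le t)

theorem Params.Valid.eight_mul_le (ha : a.Valid Wh) (hW : 0 ≤ Wh) (t : ℕ) : 8 * Wh ≤ a.β t :=
  le_trans (by nlinarith [ha.four_le_τ]) (ha.two_mul_τ_le t)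

theorem Params.Valid.moreau_param (ha : a.Valid Wh) (t : ℕ) :
    2 * (Wh * (a.τ / a.β t)) ≤ 1 := by
  have := ha.two_mul_τ_le t
  have e : 2 * (Wh * (a.τ / a.β t)) = 2 * a.τ * Wh / a.β t := by ring
  rw [e, div_le_one (ha.β_pos t)]
  exact this

/-- Errors of order `(β^{t+1} - β^t) / (β^t)²` telescope. -/
theorem Params.Valid.div_sq_le (ha : a.Valid Wh) (t : ℕ) :
    (a.β (t + 1) - a.β t) / a.β t ^ 2
      ≤ (1 + a.ξ) * (1 / a.β t - 1 / a.β (t + 1)) := by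
  have h0 := ha.β_pos t
  have h1 := ha.β_pos (t + 1)
  have h2 := ha.β_mono t.le_succ
  have e : (1 + a.ξ) * (1 / a.β t - 1 / a.β (t + 1))
      = (1 + a.ξ) * a.β t * (a.β (t + 1) - a.β t) / (a.β t ^ 2 * a.β (t + 1)) := by
    field_simp
  rw [e, div_le_div_iff₀ (by positivity) (by positivity)]
  have h3 := mul_le_mul_of_nonneg_left (ha.β_succ_le t)
    (show 0 ≤ (a.β (t + 1) - a.β t) * a.β t ^ 2 from
      mul_nonneg (sub_nonneg.2 h2) (by positivity))
  linarith

end Penalty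

/-! ### Consequences of a single iteration -/

section Step

variable {n r m : ℕ} {P : Problem n r m} {Lf Cg Ch : ℝ≥0} {Wh : ℝ}
  {R : Mat n r → Mat n r → Mat n r} {a : Params} {s : Iterates n r m} {t : ℕ}

/-- The multiplier `z^t + β^t (A X^{t+1} - y^{t+1})`, which is the gradient of the Moreau envelope
at `y^{t+1}`. -/
noncomputable def Problem.dual (P : Problem n r m) (a : Params) (s : Iterates n r m) (t : ℕ) : Vec m :=
  s.z t + a.β t • (P.A (s.X (t + 1)) - s.y (t + 1))

/-- The search direction of iteration `t`. -/
noncomputable def Problem.dirAt (P : Problem n r m) (a : Params) (s : Iterates n r m) (t : ℕ) : Mat n r :=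
  P.direction a.ρ (a.β t) (s.X t) (s.y t) (s.z t) (s.v t)

theorem Problem.center_eq (ha : a.Valid Wh) :
    P.center a s t = P.A (s.X (t + 1)) + (1 / a.β t) • s.z t := by
  have := (ha.β_pos t).ne'
  unfold Problem.center
  rw [gradient_smoothPart_right, smul_neg, smul_add, smul_smul, one_div_mul_cancel this, one_smul]
  abel

theorem Problem.dual_eq (ha : a.Valid Wh) :
    P.dual a s t = a.β t • (P.center a s t - s.y (t + 1)) := by
  have := (ha.β_pos t).ne'
  rw [Problem.center_eq ha, Problem.dual, add_sub_right_comm, smul_add, smul_smul,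
    mul_one_div_cancel this, one_smul, add_comm]

theorem Problem.IsStep.proxPair (hP : P.Assumptions Lf Cg Ch Wh) (ha : a.Valid Wh)
    (h : P.IsStep R a s t) :
    ProxPair P.h Wh (a.τ / a.β t) (s.yBr (t + 1)) (s.y (t + 1)) (P.dual a s t) := by
  have hβ := ha.β_pos t
  have hτ := ha.four_le_τ
  rw [Problem.dual_eq ha]
  refine proxPair_of_isMinOn hP.h_lip hP.Wh_nonneg hP.h_weaklyConvex (by positivity) hβ
    (ha.moreau_param t) ?_ h.yBr_succ h.y_succ
  have := ha.eight_mul_le hP.Wh_nonneg t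
  linarith [hP.Wh_nonneg]

theorem Problem.IsStep.norm_dual_le (hP : P.Assumptions Lf Cg Ch Wh) (ha : a.Valid Wh)
    (h : P.IsStep R a s t) : ‖P.dual a s t‖ ≤ Ch :=
  (h.proxPair hP ha).norm_le hP.h_lip hP.Wh_nonneg

theorem Problem.IsStep.z_sub (h : P.IsStep R a s t) :
    s.z (t + 1) - s.z t = a.σ • (P.dual a s t - s.z t) := by
  rw [h.z_succ, Problem.dual, add_sub_cancel_left, add_sub_cancel_left, smul_smul]

theorem Problem.IsStep.norm_z_succ_le (hP : P.Assumptions Lf Cg Ch Wh) (ha : a.Valid Wh)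
    (h : P.IsStep R a s t) : ‖s.z (t + 1)‖ ≤ (a.σ - 1) * ‖s.z t‖ + a.σ * Ch := by
  have e : s.z (t + 1) = a.σ • P.dual a s t - (a.σ - 1) • s.z t := by
    have := h.z_sub
    rw [sub_eq_iff_eq_add] at this
    rw [this]; module
  have hσ := ha.one_le_σ
  rw [e]
  refine (norm_sub_le _ _).trans ?_
  rw [norm_smul, norm_smul, Real.norm_eq_abs, Real.norm_eq_abs, abs_of_nonneg (by linarith),
    abs_of_nonneg (by linarith)]
  nlinarith [h.norm_dual_le hP ha]

/-- The residual of the constraint is governed by the increment of the multiplier. -/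
theorem Problem.IsStep.β_mul_norm_le (ha : a.Valid Wh) (h : P.IsStep R a s t) :
    a.β t * ‖P.A (s.X (t + 1)) - s.y (t + 1)‖ ≤ ‖s.z (t + 1) - s.z t‖ := by
  have hβ := ha.β_pos t
  have hσ := ha.one_le_σ
  rw [h.z_succ, add_sub_cancel_left, norm_smul, Real.norm_eq_abs, abs_of_nonneg (by positivity)]
  have : 0 ≤ a.β t * ‖P.A (s.X (t + 1)) - s.y (t + 1)‖ := by positivity
  nlinarith

theorem Problem.IsStep.j_le (h : P.IsStep R a s t) {J : ℕ}
    (hJ : P.TrialSucceeds R a s t (s.v t) (s.b t) J) : s.j t ≤ J := h.j_least.2 hJ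

theorem Problem.IsStep.X_succ_mem (hR : IsRetraction R) (h : P.IsStep R a s t)
    (hX : s.X t ∈ stiefel n r) : s.X (t + 1) ∈ stiefel n r := by
  rw [h.X_succ, ← neg_smul]
  exact hR.mem _ hX _ (smul_mem_tangent (searchDir_mem_tangent _ hX _) _)

/-- The decrease of the augmented Lagrangian in the `X`-update. -/
theorem Problem.IsStep.lagrangian_X_le (ha : a.Valid Wh) (h : P.IsStep R a s t) {J : ℕ}
    (hJ : P.TrialSucceeds R a s t (s.v t) (s.b t) J) :
    P.lagrangian a.τ (s.X (t + 1)) (s.y t) (s.z t) (a.β t)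
      + a.δ * a.bLow * a.γ ^ J * (‖P.dirAt a s t‖ ^ 2 / a.β t)
      ≤ P.lagrangian a.τ (s.X t) (s.y t) (s.z t) (a.β t) := by
  have hβ := ha.β_pos t
  have hls := h.j_least.1
  have hj := h.j_le hJ
  simp only [mem_ofPred_eq, Problem.TrialSucceeds, Problem.LineSearchTest] at hls
  rw [← h.X_succ] at hls
  change _ ≤ -(_ * _ * ‖P.dirAt a s t‖ ^ 2) at hls
  have hγ : a.γ ^ J ≤ a.γ ^ s.j t := pow_le_pow_of_le_one ha.γ_pos.le ha.γ_lt.le hj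
  have hγ0 : 0 < a.γ ^ J := pow_pos ha.γ_pos J
  have hb := h.b_mem.1
  have hb0 := ha.bLow_pos
  have hb1 : 0 < s.b t := hb0.trans hb
  have hδ := ha.δ_pos
  have : a.δ * a.bLow * a.γ ^ J * (‖P.dirAt a s t‖ ^ 2 / a.β t)
      ≤ a.δ * (s.b t * a.γ ^ s.j t / a.β t) * ‖P.dirAt a s t‖ ^ 2 := by
    calc _ = a.δ * (a.bLow * a.γ ^ J / a.β t) * ‖P.dirAt a s t‖ ^ 2 := by ring
      _ ≤ _ := by gcongr
  linarith

/-- The decrease of the augmented Lagrangian in the `y`-update. -/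
theorem Problem.IsStep.lagrangian_y_le (hP : P.Assumptions Lf Cg Ch Wh) (ha : a.Valid Wh)
    (h : P.IsStep R a s t) :
    P.lagrangian a.τ (s.X (t + 1)) (s.y (t + 1)) (s.z t) (a.β t)
      + 3 / 8 * (a.β t * ‖s.y (t + 1) - s.y t‖ ^ 2)
      ≤ P.lagrangian a.τ (s.X (t + 1)) (s.y t) (s.z t) (a.β t) := by
  have hβ := ha.β_pos t
  have hτ := ha.four_le_τ
  have hg := (h.proxPair hP ha).growth hP.h_lip hP.Wh_nonneg (by positivity) (ha.moreau_param t)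
    (Problem.dual_eq ha) (s.y t)
  -- completing the square
  have sq : ∀ y : Vec m, a.β t / 2 * ‖y - P.center a s t‖ ^ 2
      = inner ℝ (s.z t) (P.A (s.X (t + 1)) - y) + a.β t / 2 * ‖P.A (s.X (t + 1)) - y‖ ^ 2
        + ‖s.z t‖ ^ 2 / (2 * a.β t) := fun y => by
    have e : y - P.center a s t
        = -((P.A (s.X (t + 1)) - y) + (1 / a.β t) • s.z t) := by
      rw [Problem.center_eq ha]; abel
    rw [e, norm_neg, norm_add_sq_real, inner_smul_right, norm_smul, mul_pow, Real.norm_eq_abs,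
      sq_abs, real_inner_comm]
    field_simp
    ring
  rw [sq, sq, norm_sub_rev (s.y t)] at hg
  have h8 := ha.eight_mul_le hP.Wh_nonneg t
  have h9 : 3 / 8 * (a.β t * ‖s.y (t + 1) - s.y t‖ ^ 2)
      ≤ (a.β t / 2 - Wh) * ‖s.y (t + 1) - s.y t‖ ^ 2 := by
    rw [← mul_assoc]
    gcongr
    linarith
  unfold Problem.lagrangian Problem.smoothPart
  linarith

/-- The increase of the augmented Lagrangian in the update of the multiplier. -/
theorem Problem.IsStep.lagrangian_z_eq (ha : a.Valid Wh) (h : P.IsStep R a s t) (β : ℝ) :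
    P.lagrangian a.τ (s.X (t + 1)) (s.y (t + 1)) (s.z (t + 1)) β
      = P.lagrangian a.τ (s.X (t + 1)) (s.y (t + 1)) (s.z t) β
        + 1 / a.σ * (‖s.z (t + 1) - s.z t‖ ^ 2 / a.β t) := by
  have hβ := (ha.β_pos t).ne'
  have hσ : a.σ ≠ 0 := by linarith [ha.one_le_σ]
  have h1 : inner ℝ (s.z (t + 1)) (P.A (s.X (t + 1)) - s.y (t + 1))
      = inner ℝ (s.z t) (P.A (s.X (t + 1)) - s.y (t + 1))
        + 1 / a.σ * (‖s.z (t + 1) - s.z t‖ ^ 2 / a.β t) := by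
    rw [h.z_succ, add_sub_cancel_left, inner_add_left, inner_smul_left, norm_smul, mul_pow,
      Real.norm_eq_abs, sq_abs, real_inner_self_eq_norm_sq]
    simp only [conj_trivial]
    field_simp
  unfold Problem.lagrangian Problem.smoothPart
  rw [h1]
  ring

/-- The increase of the augmented Lagrangian in the update of the penalty, which also decreases
the smoothing parameter. -/
theorem Problem.IsStep.lagrangian_β_le (hP : P.Assumptions Lf Cg Ch Wh) (ha : a.Valid Wh)
    (h : P.IsStep R a s t) {B : ℝ}
    (hB : a.β t * ‖P.A (s.X (t + 1)) - s.y (t + 1)‖ ≤ B) (z : Vec m) :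
    P.lagrangian a.τ (s.X (t + 1)) (s.y (t + 1)) z (a.β (t + 1))
      ≤ P.lagrangian a.τ (s.X (t + 1)) (s.y (t + 1)) z (a.β t)
        + (1 + a.ξ) * ((B ^ 2 + a.τ * Ch ^ 2) / 2) * (1 / a.β t - 1 / a.β (t + 1)) := by
  have hβ := ha.β_pos t
  have hβ' := ha.β_pos (t + 1)
  have hmono := ha.β_mono t.le_succ
  have hτ := ha.four_le_τ
  have hmor := (h.proxPair hP ha).moreau_le_add hP.h_lip hP.Wh_nonneg (by positivity)
    (by have := ha.moreau_param t
        have : 0 ≤ Wh * (a.τ / a.β t) := mul_nonneg hP.Wh_nonneg (by positivity)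
        linarith)
    (μ' := a.τ / a.β (t + 1)) (by positivity) (by gcongr)
  have hdiv := ha.div_sq_le t
  set ν := ‖P.A (s.X (t + 1)) - s.y (t + 1)‖
  set d := (a.β (t + 1) - a.β t) / a.β t ^ 2 with hd
  have hd0 : 0 ≤ d := div_nonneg (sub_nonneg.2 hmono) (by positivity)
  have e1 : (1 / (a.τ / a.β (t + 1)) - 1 / (a.τ / a.β t)) * ((a.τ / a.β t) ^ 2 * Ch ^ 2 / 2)
      = a.τ * Ch ^ 2 / 2 * d := by
    rw [hd]; field_simp
  have e2 : a.β (t + 1) / 2 * ν ^ 2 = a.β t / 2 * ν ^ 2 + (a.β t * ν) ^ 2 / 2 * d := by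
    rw [hd]; field_simp; ring
  have h3 : (a.β t * ν) ^ 2 / 2 * d ≤ B ^ 2 / 2 * d := by gcongr
  have h4 := mul_le_mul_of_nonneg_left hdiv
    (show 0 ≤ (B ^ 2 + a.τ * Ch ^ 2) / 2 by positivity)
  unfold Problem.lagrangian Problem.smoothPart
  change P.f _ + _ + a.β (t + 1) / 2 * ν ^ 2 - _ + _
    ≤ P.f _ + _ + a.β t / 2 * ν ^ 2 - _ + _ + _
  rw [e1] at hmor
  rw [e2]
  linarith

/-- The increments of the multiplier contract, up to the increments of `y` and of the smoothing
parameter. -/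
theorem norm_z_sub_sq_le (hP : P.Assumptions Lf Cg Ch Wh) (ha : a.Valid Wh)
    (h : P.IsStep R a s t) (h' : P.IsStep R a s (t + 1)) :
    ‖s.z (t + 2) - s.z (t + 1)‖ ^ 2 / a.β (t + 1)
      ≤ (a.σ - 1) / (2 - a.σ) * (‖s.z (t + 1) - s.z t‖ ^ 2 / a.β t
          - ‖s.z (t + 2) - s.z (t + 1)‖ ^ 2 / a.β (t + 1))
        + a.σ ^ 2 / 8 * (a.β (t + 1) * ‖s.y (t + 2) - s.y (t + 1)‖ ^ 2)
        + 2 * a.σ ^ 2 * Ch ^ 2 * a.ξ / (2 - a.σ) ^ 2 * (1 / a.β t - 1 / a.β (t + 1)) := by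
  have hβ := ha.β_pos t
  have hβ' := ha.β_pos (t + 1)
  have hmono := ha.β_mono t.le_succ
  have hratio := ha.β_succ_le t
  have hτ := ha.four_le_τ
  have hσ1 := ha.one_le_σ
  have hσ2 : 0 < 2 - a.σ := by linarith [ha.σ_lt]
  have hξ := ha.ξ_pos
  have hτσ : 4 ≤ a.τ * (2 - a.σ) := (div_le_iff₀ hσ2).1 ha.τ_ge
  set x := ‖s.z (t + 1) - s.z t‖
  set x' := ‖s.z (t + 2) - s.z (t + 1)‖
  set Y := ‖s.y (t + 2) - s.y (t + 1)‖ with hY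
  set d := ‖P.dual a s (t + 1) - P.dual a s t‖ with hd
  set β := a.β t
  set β' := a.β (t + 1)
  have hx : x' ≤ (a.σ - 1) * x + a.σ * d := by
    have e : s.z (t + 2) - s.z (t + 1)
        = a.σ • (P.dual a s (t + 1) - P.dual a s t) - (a.σ - 1) • (s.z (t + 1) - s.z t) := by
      have e1 := h.z_sub
      have e2 : s.z (t + 2) - s.z (t + 1) = a.σ • (P.dual a s (t + 1) - s.z (t + 1)) := h'.z_sub
      have e3 : s.z (t + 1) = s.z t + a.σ • (P.dual a s t - s.z t) := by
        rw [← e1]; abel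
      rw [e2, e3]; module
    have : x' ≤ _ := (congrArg norm e).le.trans (norm_sub_le _ _)
    rw [norm_smul, norm_smul, Real.norm_eq_abs, Real.norm_eq_abs, abs_of_nonneg (by linarith),
      abs_of_nonneg (by linarith)] at this
    linarith
  have hdle : d ≤ β' / a.τ * Y + (β' - β) / β * Ch := by
    have := (h'.proxPair hP ha).norm_gradient_sub_le hP.h_lip hP.Wh_nonneg (by positivity)
      (ha.moreau_param (t + 1)) (h.proxPair hP ha)
    change a.τ / β' * d ≤ Y + |a.τ / β' - a.τ / β| * Ch at this
    have hle : a.τ / β' ≤ a.τ / β := by gcongr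
    rw [abs_of_nonpos (sub_nonpos.2 hle)] at this
    have h2 := mul_le_mul_of_nonneg_left this (show 0 ≤ β' / a.τ by positivity)
    have e1 : β' / a.τ * (a.τ / β' * d) = d := by field_simp
    have e2 : β' / a.τ * (Y + -(a.τ / β' - a.τ / β) * Ch)
        = β' / a.τ * Y + (β' - β) / β * Ch := by field_simp; ring
    rwa [e1, e2] at h2
  -- convexity of the square, with weights `σ - 1` and `2 - σ`
  have hsq : x' ^ 2 ≤ (a.σ - 1) * x ^ 2 + a.σ ^ 2 / (2 - a.σ) * d ^ 2 := by
    have h1 : x' ^ 2 ≤ ((a.σ - 1) * x + a.σ * d) ^ 2 := pow_le_pow_left₀ (norm_nonneg _) hx 2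
    have e : (a.σ - 1) * x ^ 2 + a.σ ^ 2 / (2 - a.σ) * d ^ 2 - ((a.σ - 1) * x + a.σ * d) ^ 2
        = (a.σ - 1) / (2 - a.σ) * ((2 - a.σ) * x - a.σ * d) ^ 2 := by field_simp; ring
    have : 0 ≤ (a.σ - 1) / (2 - a.σ) * ((2 - a.σ) * x - a.σ * d) ^ 2 :=
      mul_nonneg (div_nonneg (by linarith) hσ2.le) (sq_nonneg _)
    linarith
  have hd2 : d ^ 2 ≤ 2 * (β' / a.τ * Y) ^ 2 + 2 * ((β' - β) / β * Ch) ^ 2 := by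
    have h1 := pow_le_pow_left₀ (norm_nonneg _) hdle 2
    nlinarith [sq_nonneg (β' / a.τ * Y - (β' - β) / β * Ch)]
  have hτ2 : 1 / a.τ ^ 2 ≤ (2 - a.σ) ^ 2 / 16 := by
    rw [div_le_div_iff₀ (by positivity) (by norm_num)]
    nlinarith
  have hr : ((β' - β) / β) ^ 2 / β' ≤ a.ξ * (1 / β - 1 / β') := by
    have e : ((β' - β) / β) ^ 2 / β' = (β' - β) / β * (1 / β - 1 / β') := by
      field_simp
    rw [e]
    have h1 : 0 ≤ 1 / β - 1 / β' := sub_nonneg.2 (one_div_le_one_div_of_le hβ hmono)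
    have h2 : (β' - β) / β ≤ a.ξ := by rw [div_le_iff₀ hβ]; linarith
    gcongr
  -- divide by `β'` and collect
  have hx2 : x ^ 2 / β' ≤ x ^ 2 / β := by gcongr
  have hmain : x' ^ 2 / β' ≤ (a.σ - 1) * (x ^ 2 / β)
      + (2 - a.σ) * (a.σ ^ 2 / 8 * (β' * Y ^ 2))
      + (2 - a.σ) * (2 * a.σ ^ 2 * Ch ^ 2 * a.ξ / (2 - a.σ) ^ 2 * (1 / β - 1 / β')) := by
    calc x' ^ 2 / β' ≤ ((a.σ - 1) * x ^ 2 + a.σ ^ 2 / (2 - a.σ) *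
            (2 * (β' / a.τ * Y) ^ 2 + 2 * ((β' - β) / β * Ch) ^ 2)) / β' := by
          gcongr
          refine hsq.trans ?_
          gcongr
      _ = (a.σ - 1) * (x ^ 2 / β') + 2 * a.σ ^ 2 / (2 - a.σ) * (β' * Y ^ 2) * (1 / a.τ ^ 2)
            + 2 * a.σ ^ 2 / (2 - a.σ) * Ch ^ 2 * (((β' - β) / β) ^ 2 / β') := by
          field_simp
          ring
      _ ≤ (a.σ - 1) * (x ^ 2 / β) + 2 * a.σ ^ 2 / (2 - a.σ) * (β' * Y ^ 2) * ((2 - a.σ) ^ 2 / 16)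
            + 2 * a.σ ^ 2 / (2 - a.σ) * Ch ^ 2 * (a.ξ * (1 / β - 1 / β')) := by
          have : 0 ≤ a.σ - 1 := by linarith
          gcongr
      _ = _ := by field_simp; ring
  have hfin : (2 - a.σ) * (x' ^ 2 / β') ≤ (2 - a.σ) * ((a.σ - 1) / (2 - a.σ) *
      (x ^ 2 / β - x' ^ 2 / β') + a.σ ^ 2 / 8 * (β' * Y ^ 2)
        + 2 * a.σ ^ 2 * Ch ^ 2 * a.ξ / (2 - a.σ) ^ 2 * (1 / β - 1 / β')) := by
    have e : (2 - a.σ) * ((a.σ - 1) / (2 - a.σ) * (x ^ 2 / β - x' ^ 2 / β'))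
        = (a.σ - 1) * (x ^ 2 / β - x' ^ 2 / β') := by field_simp
    rw [mul_add, mul_add, e]
    linarith
  exact le_of_mul_le_mul_left hfin hσ2

end Step

/-! ### Uniform bounds along a run -/

section Run

variable {n r m : ℕ} {P : Problem n r m} {Lf Cg Ch : ℝ≥0} {Wh : ℝ}
  {R : Mat n r → Mat n r → Mat n r} {a : Params} {X₀ : Mat n r} {y₀ z₀ : Vec m}
  {N : ℕ} {s : Iterates n r m} {t : ℕ}

theorem Problem.IsRun.X_mem (hR : IsRetraction R) (hX₀ : X₀ ∈ stiefel n r)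
    (h : P.IsRun R a X₀ y₀ z₀ N s) (ht : t ≤ N) : s.X t ∈ stiefel n r := by
  induction t with
  | zero => rw [h.X_zero]; exact hX₀
  | succ t ih => exact (h.step t ht).X_succ_mem hR (ih (Nat.le_of_succ_le ht))

/-- The multipliers stay bounded: each one is the combination of the previous one with weight
`1 - σ ∈ (-1, 0]` and of a gradient of the Moreau envelope with weight `σ`. -/
theorem Problem.IsRun.norm_z_le (hP : P.Assumptions Lf Cg Ch Wh) (ha : a.Valid Wh)
    (h : P.IsRun R a X₀ y₀ z₀ N s) (ht : t ≤ N) : ‖s.z t‖ ≤ ‖z₀‖ + 2 * Ch / (2 - a.σ) := by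
  have hσ1 := ha.one_le_σ
  have hσ2 : 0 < 2 - a.σ := by linarith [ha.σ_lt]
  induction t with
  | zero => rw [h.z_zero]; exact le_add_of_nonneg_right (by positivity)
  | succ t ih =>
    refine ((h.step t ht).norm_z_succ_le hP ha).trans ?_
    have ih := ih (Nat.le_of_succ_le ht)
    have e : 2 * (Ch : ℝ) = (2 - a.σ) * (2 * Ch / (2 - a.σ)) := by field_simp
    have h1 := mul_le_mul_of_nonneg_left ih (show 0 ≤ a.σ - 1 by linarith)
    have h2 : 0 ≤ (2 - a.σ) * ‖z₀‖ := by positivity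
    have h3 : a.σ * (Ch : ℝ) ≤ 2 * Ch := by
      have := ha.σ_lt
      gcongr
    linarith

theorem exists_run_bound (hP : P.Assumptions Lf Cg Ch Wh) (ha : a.Valid Wh) :
    ∃ B : ℝ, 0 ≤ B ∧ ∀ (N : ℕ) (s : Iterates n r m), P.IsRun R a X₀ y₀ z₀ N s → ∀ t ≤ N,
      ‖s.z t‖ ≤ B ∧ a.β t * ‖P.A (s.X t) - s.y t‖ ≤ B := by
  have hσ2 : 0 < 2 - a.σ := by linarith [ha.σ_lt]
  have hξ := ha.ξ_pos
  have hβ₀ := ha.β₀_pos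
  set Bz := ‖z₀‖ + 2 * Ch / (2 - a.σ) with hBz
  have hBz0 : 0 ≤ Bz := by positivity
  refine ⟨Bz + (1 + a.ξ) * (Bz + Bz) + a.β₀ * ‖P.A X₀ - y₀‖, by positivity, ?_⟩
  intro N s h t ht
  have hz := h.norm_z_le hP ha ht
  have hA0 : 0 ≤ a.β₀ * ‖P.A X₀ - y₀‖ := by positivity
  have hB0 : 0 ≤ (1 + a.ξ) * (Bz + Bz) := by positivity
  refine ⟨by linarith, ?_⟩
  cases t with
  | zero => rw [h.X_zero, h.y_zero, ha.β_zero]; linarith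
  | succ t =>
    have h1 := (h.step t ht).β_mul_norm_le ha
    have h2 : ‖s.z (t + 1) - s.z t‖ ≤ Bz + Bz :=
      (norm_sub_le _ _).trans (add_le_add hz (h.norm_z_le hP ha (Nat.le_of_succ_le ht)))
    have h3 : a.β (t + 1) * ‖P.A (s.X (t + 1)) - s.y (t + 1)‖
        ≤ (1 + a.ξ) * (Bz + Bz) := by
      calc _ ≤ (1 + a.ξ) * a.β t * ‖P.A (s.X (t + 1)) - s.y (t + 1)‖ := by
            gcongr; exact ha.β_succ_le t
        _ = (1 + a.ξ) * (a.β t * ‖P.A (s.X (t + 1)) - s.y (t + 1)‖) := by ring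
        _ ≤ _ := by gcongr; exact h1.trans h2
    linarith

/-- The linearization of the smooth part and a subgradient of `g` are bounded along a run. -/
theorem exists_linearization_bound (hP : P.Assumptions Lf Cg Ch Wh) (hR : IsRetraction R)
    (ha : a.Valid Wh) (hX₀ : X₀ ∈ stiefel n r) :
    ∃ B : ℝ, 0 ≤ B ∧ ∀ (N : ℕ) (s : Iterates n r m), P.IsRun R a X₀ y₀ z₀ N s → ∀ t ≤ N,
      ∀ v ∈ limitingSubdiff P.g (s.X t),
        ‖gradient (fun X' => P.smoothPart X' (s.y t) (s.z t) (a.β t)) (s.X t) - v‖ ≤ B := by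
  obtain ⟨B, hB0, hB⟩ := exists_run_bound (R := R) (X₀ := X₀) (y₀ := y₀) (z₀ := z₀) hP ha
  obtain ⟨F, hF⟩ := isCompact_stiefel.exists_bound_of_continuousOn
    (hP.f_smooth.continuous.continuousOn (s := stiefel n r))
  refine ⟨|F| + ‖P.A‖ * (B + B) + Cg, by positivity, fun N s h t ht v hv => ?_⟩
  obtain ⟨hz, hy⟩ := hB N s h t ht
  rw [gradient_smoothPart_left hP.f_diff]
  refine (norm_sub_le _ _).trans (add_le_add ((norm_add_le _ _).trans (add_le_add ?_ ?_)) ?_)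
  · exact (hF _ (h.X_mem hR hX₀ ht)).trans (le_abs_self F)
  · refine (ContinuousLinearMap.le_opNorm _ _).trans ?_
    rw [LinearIsometryEquiv.norm_map]
    gcongr
    refine (norm_add_le _ _).trans (add_le_add hz ?_)
    rwa [norm_smul, Real.norm_eq_abs, abs_of_pos (ha.β_pos t)]
  · exact norm_le_of_mem_limitingSubdiff hP.g_lip hv

/-- A fixed trial `J` passes the line search test in every iteration of every run, so that the line
search stops at a stepsize of at least `bLow γ ^ J / β^t`. -/
theorem exists_trialSucceeds (hP : P.Assumptions Lf Cg Ch Wh) (hR : IsRetraction R)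
    (ha : a.Valid Wh) (hX₀ : X₀ ∈ stiefel n r) :
    ∃ J : ℕ, ∀ (N : ℕ) (s : Iterates n r m), P.IsRun R a X₀ y₀ z₀ N s → ∀ t ≤ N,
      ∀ v ∈ limitingSubdiff P.g (s.X t), ∀ b ∈ Ioo a.bLow a.bHigh,
        P.TrialSucceeds R a s t v b J := by
  obtain ⟨B, hB0, hB⟩ := exists_linearization_bound (y₀ := y₀) (z₀ := z₀) hP hR ha hX₀
  obtain ⟨J, hJ⟩ := exists_lineSearchTest hP hR ha hB0
  exact ⟨J, fun N s h t ht v hv b hb => hJ _ _ _ _ _ _ (ha.β₀_le t) (h.X_mem hR hX₀ ht) hv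
    (hB N s h t ht v hv) hb⟩

theorem exists_lagrangian_bound (hP : P.Assumptions Lf Cg Ch Wh) (hR : IsRetraction R)
    (ha : a.Valid Wh) (hX₀ : X₀ ∈ stiefel n r) :
    ∃ B : ℝ, 0 ≤ B ∧ ∀ (N : ℕ) (s : Iterates n r m), P.IsRun R a X₀ y₀ z₀ N s → ∀ t ≤ N,
      |P.lagrangian a.τ (s.X t) (s.y t) (s.z t) (a.β t)| ≤ B := by
  obtain ⟨B, hB0, hB⟩ := exists_run_bound (R := R) (X₀ := X₀) (y₀ := y₀) (z₀ := z₀) hP ha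
  have hcont : Continuous fun X => |P.f X| + |P.g X| + |P.h (P.A X)| := by
    have h1 := hP.f_diff.continuous
    have h2 := hP.g_lip.continuous
    have h3 := hP.h_lip.continuous
    fun_prop
  obtain ⟨F, hF⟩ := isCompact_stiefel.exists_bound_of_continuousOn
    (hcont.continuousOn (s := stiefel n r))
  have hβ₀ := ha.β₀_pos
  have hτ := ha.four_le_τ
  refine ⟨|F| + B * (B / a.β₀) + B * (B / a.β₀) + Ch * (B / a.β₀) + a.τ / a.β₀ * Ch ^ 2,
    by positivity, fun N s h t ht => ?_⟩
  obtain ⟨hz, hy⟩ := hB N s h t ht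
  have hF' := (le_abs_self _).trans ((hF _ (h.X_mem hR hX₀ ht)).trans (le_abs_self F))
  have hβ := ha.β_pos t
  have hle := ha.β₀_le t
  have hmu : 0 < a.τ / a.β t := by positivity
  have hge := moreau_ge hP.h_lip hmu (s.y t)
  have hle' := moreau_le_self hP.h_lip hmu (s.y t)
  have hLip := hP.h_lip.dist_le_mul (P.A (s.X t)) (s.y t)
  rw [dist_eq_norm, dist_eq_norm, Real.norm_eq_abs] at hLip
  have hin := abs_real_inner_le_norm (s.z t) (P.A (s.X t) - s.y t)
  set ν := ‖P.A (s.X t) - s.y t‖ with hν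
  have hν0 : 0 ≤ ν := norm_nonneg _
  have hν1 : ν ≤ B / a.β₀ := by
    rw [le_div_iff₀ hβ₀]
    nlinarith
  have hi : ‖s.z t‖ * ν ≤ B * (B / a.β₀) := by gcongr
  have hq : a.β t / 2 * ν ^ 2 ≤ B * (B / a.β₀) := by
    calc a.β t / 2 * ν ^ 2 = (a.β t * ν) * ν / 2 := by ring
      _ ≤ B * (B / a.β₀) / 2 := by gcongr
      _ ≤ _ := half_le_self (by positivity)
  have hq0 : 0 ≤ a.β t / 2 * ν ^ 2 := by positivity
  have hl : Ch * ν ≤ Ch * (B / a.β₀) := by gcongr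
  have hm : a.τ / a.β t * Ch ^ 2 / 2 ≤ a.τ / a.β₀ * Ch ^ 2 := by
    calc a.τ / a.β t * Ch ^ 2 / 2 ≤ a.τ / a.β t * Ch ^ 2 := half_le_self (by positivity)
      _ ≤ _ := by gcongr
  have hm0 : 0 ≤ a.τ / a.β₀ * Ch ^ 2 := by positivity
  unfold Problem.lagrangian Problem.smoothPart
  rw [← hν]
  have f1 := abs_le.1 (le_refl |P.f (s.X t)|)
  have f2 := abs_le.1 (le_refl |P.g (s.X t)|)
  have f3 := abs_le.1 (le_refl |P.h (P.A (s.X t))|)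
  have f4 := abs_le.1 hLip
  have f5 := abs_le.1 hin
  rw [abs_le]
  constructor <;> linarith [f1.1, f1.2, f2.1, f2.2, f3.1, f3.2, f4.1, f4.2, f5.1, f5.2]

/-! ### The potential function -/

/-- The squared increment of the multiplier in iteration `t`, weighted by `1 / β^t`. -/
noncomputable def Params.dualGap (a : Params) (s : Iterates n r m) (t : ℕ) : ℝ :=
  ‖s.z (t + 1) - s.z t‖ ^ 2 / a.β t

/-- One iteration decreases the sum of the augmented Lagrangian, a multiple of the last dual gap
and multiples of the reciprocals of the last two penalties. The increase `dualGap / σ` caused by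
the multiplier is absorbed by the decrease in `y` through the contraction of the dual gap. -/
theorem lagrangian_descent (hP : P.Assumptions Lf Cg Ch Wh) (ha : a.Valid Wh)
    (h : P.IsStep R a s t) (h' : P.IsStep R a s (t + 1)) {J : ℕ}
    (hJ : P.TrialSucceeds R a s (t + 1) (s.v (t + 1)) (s.b (t + 1)) J) {B : ℝ}
    (hB : a.β (t + 1) * ‖P.A (s.X (t + 2)) - s.y (t + 2)‖ ≤ B) :
    P.lagrangian a.τ (s.X (t + 2)) (s.y (t + 2)) (s.z (t + 2)) (a.β (t + 2))
      + a.δ * a.bLow * a.γ ^ J * (‖P.dirAt a s (t + 1)‖ ^ 2 / a.β (t + 1))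
      + 1 / 4 * a.dualGap s (t + 1)
      ≤ P.lagrangian a.τ (s.X (t + 1)) (s.y (t + 1)) (s.z (t + 1)) (a.β (t + 1))
        + (1 / a.σ + 1 / 4) * ((a.σ - 1) / (2 - a.σ)) * (a.dualGap s t - a.dualGap s (t + 1))
        + (1 / a.σ + 1 / 4) * (2 * a.σ ^ 2 * Ch ^ 2 * a.ξ / (2 - a.σ) ^ 2)
          * (1 / a.β t - 1 / a.β (t + 1))
        + (1 + a.ξ) * ((B ^ 2 + a.τ * Ch ^ 2) / 2) * (1 / a.β (t + 1) - 1 / a.β (t + 2)) := by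
  have hσ1 := ha.one_le_σ
  have h1 := h'.lagrangian_X_le ha hJ
  have h2 := h'.lagrangian_y_le hP ha
  have h3 := h'.lagrangian_z_eq ha (a.β (t + 1))
  have h4 := h'.lagrangian_β_le hP ha hB (s.z (t + 2))
  have h5 := norm_z_sub_sq_le hP ha h h'
  change a.dualGap s (t + 1) ≤ _ * (a.dualGap s t - a.dualGap s (t + 1)) + _ + _ at h5
  have h6 := mul_le_mul_of_nonneg_left h5 (show 0 ≤ 1 / a.σ + 1 / 4 by positivity)
  change _ = _ + 1 / a.σ * a.dualGap s (t + 1) at h3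
  simp only [add_assoc, Nat.reduceAdd] at h1 h2 h3 h4
  have h7 : (1 / a.σ + 1 / 4) * (a.σ ^ 2 / 8) ≤ 3 / 8 := by
    have e : (1 / a.σ + 1 / 4) * (a.σ ^ 2 / 8) = a.σ / 8 + a.σ ^ 2 / 32 := by
      field_simp; ring
    rw [e]
    nlinarith [ha.σ_lt]
  have hY : 0 ≤ a.β (t + 1) * ‖s.y (t + 2) - s.y (t + 1)‖ ^ 2 := by
    have := ha.β_pos (t + 1)
    positivity
  have h8 := mul_le_mul_of_nonneg_right h7 hY
  linarith

/-- The quantities that control the criticality measure are square-summable with weights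
`1 / β^t`. -/
theorem exists_sum_bound (hP : P.Assumptions Lf Cg Ch Wh) (hR : IsRetraction R)
    (ha : a.Valid Wh) (hX₀ : X₀ ∈ stiefel n r) :
    ∃ C : ℝ, 0 ≤ C ∧ ∀ (T : ℕ) (s : Iterates n r m), P.IsRun R a X₀ y₀ z₀ (T + 1) s →
      ∑ t ∈ Finset.Icc 1 T, ‖P.dirAt a s t‖ ^ 2 / a.β t ≤ C ∧
      ∑ t ∈ Finset.Icc 1 T, ‖s.z (t + 1) - s.z t‖ ^ 2 / a.β t ≤ C := by
  obtain ⟨B, hB0, hB⟩ := exists_run_bound (R := R) (X₀ := X₀) (y₀ := y₀) (z₀ := z₀) hP ha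
  obtain ⟨BL, hBL0, hBL⟩ := exists_lagrangian_bound (y₀ := y₀) (z₀ := z₀) hP hR ha hX₀
  obtain ⟨J, hJ⟩ := exists_trialSucceeds (y₀ := y₀) (z₀ := z₀) hP hR ha hX₀
  have hσ1 := ha.one_le_σ
  have hσ2 : 0 < 2 - a.σ := by linarith [ha.σ_lt]
  have hξ := ha.ξ_pos
  have hτ := ha.four_le_τ
  have hβ₀ := ha.β₀_pos
  set c₁ := (1 / a.σ + 1 / 4) * ((a.σ - 1) / (2 - a.σ)) with hc₁
  set c₂ := (1 / a.σ + 1 / 4) * (2 * a.σ ^ 2 * Ch ^ 2 * a.ξ / (2 - a.σ) ^ 2) with hc₂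
  set c₃ := (1 + a.ξ) * ((B ^ 2 + a.τ * Ch ^ 2) / 2) with hc₃
  set κ := a.δ * a.bLow * a.γ ^ J with hκ
  have hκ0 : 0 < κ := mul_pos (mul_pos ha.δ_pos ha.bLow_pos) (pow_pos ha.γ_pos J)
  have hc₁0 : 0 ≤ c₁ := mul_nonneg (by positivity) (div_nonneg (by linarith) hσ2.le)
  have hc₂0 : 0 ≤ c₂ := by positivity
  have hc₃0 : 0 ≤ c₃ := by positivity
  set V := 2 * BL + c₁ * ((B + B) ^ 2 / a.β₀) + c₂ / a.β₀ + c₃ / a.β₀ with hV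
  have hV0 : 0 ≤ V := by positivity
  refine ⟨V / κ + 4 * V, by positivity, fun T s h => ?_⟩
  have hdg : ∀ t, 0 ≤ a.dualGap s t := fun t => by
    have := ha.β_pos t
    unfold Params.dualGap; positivity
  -- telescoping the potential
  have htel : ∀ k ≤ T,
      P.lagrangian a.τ (s.X (k + 1)) (s.y (k + 1)) (s.z (k + 1)) (a.β (k + 1))
        + c₁ * a.dualGap s k + c₂ / a.β k + c₃ / a.β (k + 1)
        + ∑ t ∈ Finset.Icc 1 k, (κ * (‖P.dirAt a s t‖ ^ 2 / a.β t) + 1 / 4 * a.dualGap s t)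
      ≤ P.lagrangian a.τ (s.X 1) (s.y 1) (s.z 1) (a.β 1)
        + c₁ * a.dualGap s 0 + c₂ / a.β 0 + c₃ / a.β 1 := by
    intro k
    induction k with
    | zero => intro _; simp
    | succ k ih =>
      intro hk
      have ih := ih (Nat.le_of_succ_le hk)
      rw [Finset.sum_Icc_succ_top (by omega)]
      have hst := h.step (k + 1) (by omega)
      have hy := (hB _ s h (k + 2) (by omega)).2
      have hmono : a.β (k + 1) ≤ a.β (k + 2) := ha.β_mono (by omega)
      have hd := lagrangian_descent hP ha (h.step k (by omega)) hst
        (hJ _ s h (k + 1) (by omega) _ hst.v_mem _ hst.b_mem) (B := B)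
        ((mul_le_mul_of_nonneg_right hmono (norm_nonneg _)).trans hy)
      rw [← hc₁, ← hc₂, ← hc₃, ← hκ] at hd
      simp only [div_eq_mul_one_div c₂, div_eq_mul_one_div c₃] at ih ⊢
      change P.lagrangian a.τ (s.X (k + 2)) (s.y (k + 2)) (s.z (k + 2)) (a.β (k + 2)) + _ + _
        + c₃ * (1 / a.β (k + 2)) + _ ≤ _
      linarith
  have h1 := htel T le_rfl
  have hL1 := (abs_le.1 (hBL _ s h 1 (by omega))).2
  have hLT := (abs_le.1 (hBL _ s h (T + 1) le_rfl)).1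
  have hβT := ha.β_pos T
  have hβT' := ha.β_pos (T + 1)
  have hg0 : a.dualGap s 0 ≤ (B + B) ^ 2 / a.β₀ := by
    unfold Params.dualGap
    rw [ha.β_zero]
    gcongr
    exact (norm_sub_le _ _).trans
      (add_le_add (hB _ s h 1 (by omega)).1 (hB _ s h 0 (by omega)).1)
  have h2 : c₁ * a.dualGap s 0 ≤ c₁ * ((B + B) ^ 2 / a.β₀) := by gcongr
  have h3 : c₂ / a.β 0 ≤ c₂ / a.β₀ := by rw [ha.β_zero]
  have h4 : c₃ / a.β 1 ≤ c₃ / a.β₀ := by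
    have := ha.β₀_le 1
    gcongr
  have h5 : 0 ≤ c₁ * a.dualGap s T := mul_nonneg hc₁0 (hdg T)
  have h6 : 0 ≤ c₂ / a.β T := by positivity
  have h7 : 0 ≤ c₃ / a.β (T + 1) := by positivity
  have hsum : ∑ t ∈ Finset.Icc 1 T, (κ * (‖P.dirAt a s t‖ ^ 2 / a.β t) + 1 / 4 * a.dualGap s t)
      ≤ V := by rw [hV]; linarith
  rw [Finset.sum_add_distrib, ← Finset.mul_sum, ← Finset.mul_sum] at hsum
  have hs1 : 0 ≤ ∑ t ∈ Finset.Icc 1 T, ‖P.dirAt a s t‖ ^ 2 / a.β t :=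
    Finset.sum_nonneg fun t _ => by have := ha.β_pos t; positivity
  have hs2 : 0 ≤ ∑ t ∈ Finset.Icc 1 T, a.dualGap s t := Finset.sum_nonneg fun t _ => hdg t
  constructor
  · have : ∑ t ∈ Finset.Icc 1 T, ‖P.dirAt a s t‖ ^ 2 / a.β t ≤ V / κ := by
      rw [le_div_iff₀ hκ0]; linarith
    linarith
  · change ∑ t ∈ Finset.Icc 1 T, a.dualGap s t ≤ _
    have := mul_nonneg hκ0.le hs1
    have : 0 ≤ V / κ := by positivity
    linarith

end Run

/-! ### The criticality measure and its average -/

section Rate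

variable {n r m : ℕ} {P : Problem n r m} {Lf Cg Ch : ℝ≥0} {Wh : ℝ}
  {R : Mat n r → Mat n r → Mat n r} {a : Params} {X₀ : Mat n r} {y₀ z₀ : Vec m}
  {s : Iterates n r m} {t : ℕ}

/-- After iteration `t`, the criticality measure is controlled by the increment of the multiplier,
the smoothing parameter and the search direction at the new point, whichever subgradient `v` of
`g` is chosen there. -/
theorem Problem.IsStep.crit_le (hP : P.Assumptions Lf Cg Ch Wh) (ha : a.Valid Wh)
    (h : P.IsStep R a s t) (hX : s.X (t + 1) ∈ stiefel n r) {v : Mat n r}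
    (hv : v ∈ limitingSubdiff P.g (s.X (t + 1))) :
    P.crit (s.X (t + 1)) (s.yBr (t + 1)) (s.z (t + 1))
      ≤ ENNReal.ofReal ((1 / a.β₀ + 1 + ‖P.A‖ * (1 + a.ξ)) * ‖s.z (t + 1) - s.z t‖
        + a.τ * Ch * (1 / a.β t) + (1 + 1 / a.ρ) * ‖P.direction a.ρ (a.β (t + 1)) (s.X (t + 1))
          (s.y (t + 1)) (s.z (t + 1)) v‖) := by
  have hβ := ha.β_pos t
  have hβ' := ha.β_pos (t + 1)
  have hβ₀ := ha.β₀_pos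
  have hτ := ha.four_le_τ
  have hσ := ha.one_le_σ
  have hξ := ha.ξ_pos
  have hρ := ha.ρ_pos
  have hp := h.proxPair hP ha
  have hres := h.β_mul_norm_le ha
  set x := ‖s.z (t + 1) - s.z t‖ with hx
  set w := P.dual a s t with hw
  set G := gradient (fun X' => P.smoothPart X' (s.y (t + 1)) (s.z (t + 1)) (a.β (t + 1)))
    (s.X (t + 1)) - v with hG
  have hdir : P.direction a.ρ (a.β (t + 1)) (s.X (t + 1)) (s.y (t + 1)) (s.z (t + 1)) v
      = searchDir a.ρ (s.X (t + 1)) G := rfl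
  rw [hdir]
  set D := searchDir a.ρ (s.X (t + 1)) G with hD
  have hfeas : ‖P.A (s.X (t + 1)) - s.yBr (t + 1)‖
      ≤ 1 / a.β₀ * x + a.τ * Ch * (1 / a.β t) := by
    have e : P.A (s.X (t + 1)) - s.yBr (t + 1)
        = (P.A (s.X (t + 1)) - s.y (t + 1)) + (a.τ / a.β t) • w := by
      rw [← hp.eq]; abel
    rw [e]
    refine (norm_add_le _ _).trans (add_le_add ?_ ?_)
    · rw [one_div_mul_eq_div, le_div_iff₀ hβ₀, mul_comm]
      refine le_trans ?_ hres
      gcongr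
      exact ha.β₀_le t
    · rw [norm_smul, Real.norm_eq_abs, abs_of_nonneg (by positivity)]
      calc a.τ / a.β t * ‖w‖ ≤ a.τ / a.β t * Ch := by gcongr; exact h.norm_dual_le hP ha
        _ = _ := by ring
  have hsub : ‖w - s.z (t + 1)‖ ≤ x := by
    have e : w - s.z (t + 1) = -((1 - 1 / a.σ) • (s.z (t + 1) - s.z t)) := by
      have h1 : w = s.z t + (1 / a.σ) • (s.z (t + 1) - s.z t) := by
        rw [h.z_sub, smul_smul, one_div_mul_cancel (by linarith), one_smul]; abel
      rw [h1]; module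
    have hσ' : 0 < 1 / a.σ := by positivity
    have hσ'' : 1 / a.σ ≤ 1 := by rw [div_le_one (by linarith)]; exact hσ
    rw [e, norm_neg, norm_smul, Real.norm_eq_abs, abs_of_nonneg (by linarith)]
    exact mul_le_of_le_one_left (norm_nonneg _) (by linarith)
  have hproj : ‖tangentProj (s.X (t + 1)) (gradient P.f (s.X (t + 1)) - v
      + ContinuousLinearMap.adjoint P.A (s.z (t + 1)))‖
      ≤ ‖P.A‖ * (1 + a.ξ) * x + (1 + 1 / a.ρ) * ‖D‖ := by
    set e := ContinuousLinearMap.adjoint P.A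
      (a.β (t + 1) • (P.A (s.X (t + 1)) - s.y (t + 1))) with he
    have hGe : gradient P.f (s.X (t + 1)) - v + ContinuousLinearMap.adjoint P.A (s.z (t + 1))
        = G - e := by
      rw [hG, gradient_smoothPart_left hP.f_diff, map_add, he]; abel
    have hen : ‖e‖ ≤ ‖P.A‖ * (1 + a.ξ) * x := by
      refine (ContinuousLinearMap.le_opNorm _ _).trans ?_
      rw [LinearIsometryEquiv.norm_map, mul_assoc]
      gcongr
      rw [norm_smul, Real.norm_eq_abs, abs_of_pos hβ']
      calc _ ≤ (1 + a.ξ) * a.β t * ‖P.A (s.X (t + 1)) - s.y (t + 1)‖ := by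
            gcongr; exact ha.β_succ_le t
        _ = (1 + a.ξ) * (a.β t * ‖P.A (s.X (t + 1)) - s.y (t + 1)‖) := by ring
        _ ≤ _ := by gcongr
    rw [hGe, tangentProj_sub]
    refine (norm_sub_le _ _).trans ?_
    have h1 := norm_tangentProj_le_searchDir hρ hX G
    have h2 := norm_tangentProj_le hX e
    linarith
  have hw_mem : w ∈ limitingSubdiff P.h (s.yBr (t + 1)) :=
    frechetSubdiff_subset_limitingSubdiff _ _ (hp.sub.mem_frechetSubdiff hP.Wh_nonneg)
  have hx0 : 0 ≤ x := norm_nonneg _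
  calc P.crit (s.X (t + 1)) (s.yBr (t + 1)) (s.z (t + 1))
      ≤ ‖P.A (s.X (t + 1)) - s.yBr (t + 1)‖ₑ + ‖w - s.z (t + 1)‖ₑ
        + ‖tangentProj (s.X (t + 1)) (gradient P.f (s.X (t + 1)) - v
          + ContinuousLinearMap.adjoint P.A (s.z (t + 1)))‖ₑ := by
        unfold Problem.crit
        gcongr
        · exact iInf₂_le w hw_mem
        · exact iInf₂_le v hv
    _ = ENNReal.ofReal (‖P.A (s.X (t + 1)) - s.yBr (t + 1)‖ + ‖w - s.z (t + 1)‖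
        + ‖tangentProj (s.X (t + 1)) (gradient P.f (s.X (t + 1)) - v
          + ContinuousLinearMap.adjoint P.A (s.z (t + 1)))‖) := by
        rw [ENNReal.ofReal_add (by positivity) (by positivity),
          ENNReal.ofReal_add (by positivity) (by positivity), ofReal_norm, ofReal_norm,
          ofReal_norm]
    _ ≤ _ := by
        apply ENNReal.ofReal_le_ofReal
        linarith

theorem sum_rpow_neg_third_le (T : ℕ) :
    ∑ t ∈ Finset.Icc 1 T, (t : ℝ) ^ (-(1 / 3) : ℝ) ≤ 3 / 2 * (T : ℝ) ^ (2 / 3 : ℝ) := by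
  induction T with
  | zero => simp
  | succ T ih =>
    rw [Finset.sum_Icc_succ_top (by omega)]
    set u : ℝ := ((T + 1 : ℕ) : ℝ) with hu
    have hu1 : u = T + 1 := by rw [hu]; push_cast; ring
    have hT0 : (0 : ℝ) ≤ T := Nat.cast_nonneg T
    have hu0 : 0 < u := by linarith
    -- Bernoulli's inequality for `T / (T + 1) = 1 - 1 / (T + 1)`
    have hb : (1 + -(1 / u)) ^ (2 / 3 : ℝ) ≤ 1 + 2 / 3 * -(1 / u) :=
      rpow_one_add_le_one_add_mul_self (by
        rw [neg_le_neg_iff, div_le_one hu0]; linarith) (by norm_num) (by norm_num)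
    have hT : (T : ℝ) = u * (1 + -(1 / u)) := by rw [hu1]; field_simp; ring
    have hnn : 0 ≤ 1 + -(1 / u) := by
      have : 1 / u ≤ 1 := by rw [div_le_one hu0]; linarith
      linarith
    have h1 : (T : ℝ) ^ (2 / 3 : ℝ) ≤ u ^ (2 / 3 : ℝ) * (1 + 2 / 3 * -(1 / u)) := by
      rw [hT, Real.mul_rpow hu0.le hnn]
      gcongr
    have h2 : u ^ (-(1 / 3) : ℝ) = u ^ (2 / 3 : ℝ) * (1 / u) := by
      have : (-(1 / 3) : ℝ) = 2 / 3 - 1 := by norm_num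
      rw [this, Real.rpow_sub_one hu0.ne', mul_one_div]
    rw [h2]
    linarith

/-- A nonnegative sequence that is square-summable with weights `1 / β^t`, where `β^t` grows like
`t^(1/3)`, has partial sums `O(T^(2/3))`. -/
theorem Params.Valid.sum_le_of_sum_sq_le (ha : a.Valid Wh) (hp : a.p = 1 / 3) {C : ℝ}
    (x : ℕ → ℝ) {T : ℕ} (hT : 1 ≤ T)
    (hx : ∑ t ∈ Finset.Icc 1 T, x t ^ 2 / a.β t ≤ C) :
    ∑ t ∈ Finset.Icc 1 T, x t ≤ (1 + a.β₀ * (1 + a.ξ) * C) * (T : ℝ) ^ (2 / 3 : ℝ) := by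
  have hξ := ha.ξ_pos
  have hβ₀ := ha.β₀_pos
  have hT1 : (1 : ℝ) ≤ T := by exact_mod_cast hT
  have hT0 : (0 : ℝ) < T := by linarith
  set θ : ℝ := (T : ℝ) ^ (1 / 3 : ℝ) with hθ
  have hθ1 : 1 ≤ θ := Real.one_le_rpow hT1 (by norm_num)
  have hθ0 : 0 < θ := by linarith
  have hβT : a.β T ≤ a.β₀ * (1 + a.ξ) * θ := by
    unfold Params.β
    rw [hp, mul_assoc]
    gcongr
    linarith
  have hθ2 : θ * θ = (T : ℝ) ^ (2 / 3 : ℝ) := by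
    rw [hθ, ← Real.rpow_add hT0]; norm_num
  have hθ3 : T * (1 / θ) = (T : ℝ) ^ (2 / 3 : ℝ) := by
    rw [mul_one_div, hθ, ← Real.rpow_one_sub' hT0.le (by norm_num)]; norm_num
  -- the arithmetic-geometric mean inequality with weight `T^(-1/3)`
  have hterm : ∀ t ∈ Finset.Icc 1 T,
      x t ≤ 1 / θ + a.β₀ * (1 + a.ξ) * (θ * θ) * (x t ^ 2 / a.β t) := by
    intro t ht
    have hβ := ha.β_pos t
    have hβle : a.β t ≤ a.β₀ * (1 + a.ξ) * θ :=
      (ha.β_mono (Finset.mem_Icc.1 ht).2).trans hβT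
    have h1 : θ * x t ^ 2 ≤ a.β₀ * (1 + a.ξ) * (θ * θ) * (x t ^ 2 / a.β t) := by
      calc θ * x t ^ 2 = a.β t * θ * (x t ^ 2 / a.β t) := by field_simp
        _ ≤ a.β₀ * (1 + a.ξ) * θ * θ * (x t ^ 2 / a.β t) := by gcongr
        _ = _ := by ring
    have h2 : x t ≤ 1 / θ + θ * x t ^ 2 := by
      have e : 1 / θ + θ * x t ^ 2 - x t = 1 / θ * ((θ * x t - 1 / 2) ^ 2 + 3 / 4) := by
        field_simp; ring
      have : 0 ≤ 1 / θ * ((θ * x t - 1 / 2) ^ 2 + 3 / 4) := by positivity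
      linarith
    linarith
  calc ∑ t ∈ Finset.Icc 1 T, x t
      ≤ ∑ t ∈ Finset.Icc 1 T, (1 / θ + a.β₀ * (1 + a.ξ) * (θ * θ) * (x t ^ 2 / a.β t)) :=
        Finset.sum_le_sum hterm
    _ = T * (1 / θ) + a.β₀ * (1 + a.ξ) * (θ * θ) * ∑ t ∈ Finset.Icc 1 T, x t ^ 2 / a.β t := by
        rw [Finset.sum_add_distrib, ← Finset.mul_sum]; simp
    _ ≤ T * (1 / θ) + a.β₀ * (1 + a.ξ) * (θ * θ) * C := by gcongr
    _ = _ := by rw [hθ3, hθ2]; ring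

theorem Params.Valid.sum_one_div_β_le (ha : a.Valid Wh) (hp : a.p = 1 / 3) (T : ℕ) :
    ∑ t ∈ Finset.Icc 1 T, 1 / a.β t ≤ 1 / (a.β₀ * a.ξ) * (3 / 2) * (T : ℝ) ^ (2 / 3 : ℝ) := by
  have hξ := ha.ξ_pos
  have hβ₀ := ha.β₀_pos
  calc ∑ t ∈ Finset.Icc 1 T, 1 / a.β t
      ≤ ∑ t ∈ Finset.Icc 1 T, 1 / (a.β₀ * a.ξ) * (t : ℝ) ^ (-(1 / 3) : ℝ) := by
        refine Finset.sum_le_sum fun t ht => ?_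
        have ht0 : (0 : ℝ) < t := by exact_mod_cast (Finset.mem_Icc.1 ht).1
        have e : 1 / (a.β₀ * a.ξ) * (t : ℝ) ^ (-(1 / 3) : ℝ)
            = 1 / (a.β₀ * (a.ξ * (t : ℝ) ^ (1 / 3 : ℝ))) := by
          rw [Real.rpow_neg ht0.le]; field_simp
        rw [e]
        unfold Params.β
        rw [hp]
        gcongr
        linarith
    _ = 1 / (a.β₀ * a.ξ) * ∑ t ∈ Finset.Icc 1 T, (t : ℝ) ^ (-(1 / 3) : ℝ) := by
        rw [Finset.mul_sum]
    _ ≤ 1 / (a.β₀ * a.ξ) * (3 / 2 * (T : ℝ) ^ (2 / 3 : ℝ)) := by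
        gcongr; exact sum_rpow_neg_third_le T
    _ = _ := by ring

theorem exists_sum_crit_bound (hP : P.Assumptions Lf Cg Ch Wh) (hR : IsRetraction R)
    (ha : a.Valid Wh) (hp : a.p = 1 / 3) (hX₀ : X₀ ∈ stiefel n r) :
    ∃ C : ℝ, 0 < C ∧ ∀ T : ℕ, 1 ≤ T → ∀ s : Iterates n r m,
      P.IsRun R a X₀ y₀ z₀ (T + 1) s →
        ∑ t ∈ Finset.Icc 1 T, P.crit (s.X (t + 1)) (s.yBr (t + 1)) (s.z (t + 1))
          ≤ ENNReal.ofReal (C * (T : ℝ) ^ (2 / 3 : ℝ)) := by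
  obtain ⟨C, hC0, hC⟩ := exists_sum_bound (y₀ := y₀) (z₀ := z₀) hP hR ha hX₀
  obtain ⟨B, hB0, hB⟩ := exists_linearization_bound (y₀ := y₀) (z₀ := z₀) hP hR ha hX₀
  have hξ := ha.ξ_pos
  have hβ₀ := ha.β₀_pos
  have hτ := ha.four_le_τ
  have hρ := ha.ρ_pos
  set c₁ := 1 / a.β₀ + 1 + ‖P.A‖ * (1 + a.ξ)
  set c₂ := 1 + 1 / a.ρ
  set S := 1 + a.β₀ * (1 + a.ξ) * C
  set E := max 1 (2 * a.ρ) * B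
  have hE0 : 0 ≤ E := mul_nonneg (le_max_of_le_left zero_le_one) hB0
  refine ⟨c₁ * S + a.τ * Ch * (1 / (a.β₀ * a.ξ) * (3 / 2)) + c₂ * (S + E), by positivity,
    fun T hT s h => ?_⟩
  obtain ⟨hsD, hsz⟩ := hC T s h
  have hT1 : (1 : ℝ) ≤ (T : ℝ) ^ (2 / 3 : ℝ) :=
    Real.one_le_rpow (by exact_mod_cast hT) (by norm_num)
  have hX : ∀ t ≤ T, s.X (t + 1) ∈ stiefel n r := fun t ht => h.X_mem hR hX₀ (by omega)
  -- no iteration starts at the last point, so its search direction is bounded by a constant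
  set d : ℕ → ℝ := fun t => if t ≤ T then ‖P.dirAt a s t‖ else E with hd
  have hd0 : ∀ t, 0 ≤ d t := fun t => by rw [hd]; dsimp only; split_ifs <;> positivity
  have hterm : ∀ t ∈ Finset.Icc 1 T,
      P.crit (s.X (t + 1)) (s.yBr (t + 1)) (s.z (t + 1))
        ≤ ENNReal.ofReal (c₁ * ‖s.z (t + 1) - s.z t‖ + a.τ * Ch * (1 / a.β t)
          + c₂ * d (t + 1)) := by
    intro t ht
    have ht' := (Finset.mem_Icc.1 ht).2
    have hst := h.step t (by omega)
    by_cases hlast : t + 1 ≤ T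
    · refine (hst.crit_le hP ha (hX t ht') (h.step (t + 1) (by omega)).v_mem).trans_eq ?_
      simp only [hd, if_pos hlast]
      rfl
    · obtain ⟨v, hv⟩ := limitingSubdiff_nonempty hP.g_lip (s.X (t + 1))
      refine (hst.crit_le hP ha (hX t ht') hv).trans (ENNReal.ofReal_le_ofReal ?_)
      simp only [hd, if_neg hlast]
      gcongr
      refine (norm_searchDir_le hρ (hX t ht') _).trans ?_
      exact mul_le_mul_of_nonneg_left (hB _ s h (t + 1) (by omega) v hv)
        (le_max_of_le_left zero_le_one)
  have hsd : ∑ t ∈ Finset.Icc 1 T, d (t + 1) ≤ ∑ t ∈ Finset.Icc 1 T, ‖P.dirAt a s t‖ + E := by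
    have e : ∑ t ∈ Finset.Icc 1 T, d (t + 1) + d 1 = ∑ t ∈ Finset.Icc 1 (T + 1), d t := by
      clear_value d
      clear hterm hT hT1 hX hsD hsz h hd
      induction T with
      | zero => simp
      | succ k ih =>
        rw [Finset.sum_Icc_succ_top (by omega), Finset.sum_Icc_succ_top (by omega), ← ih]; ring
    rw [Finset.sum_Icc_succ_top (by omega)] at e
    have e1 : ∑ t ∈ Finset.Icc 1 T, d t = ∑ t ∈ Finset.Icc 1 T, ‖P.dirAt a s t‖ :=
      Finset.sum_congr rfl fun t ht => by simp only [hd, if_pos (Finset.mem_Icc.1 ht).2]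
    have e2 : d (T + 1) = E := by simp [hd]
    have := hd0 1
    linarith
  have hz := ha.sum_le_of_sum_sq_le hp _ hT hsz
  have hD := ha.sum_le_of_sum_sq_le hp _ hT hsD
  have hβs := ha.sum_one_div_β_le hp T
  calc ∑ t ∈ Finset.Icc 1 T, P.crit (s.X (t + 1)) (s.yBr (t + 1)) (s.z (t + 1))
      ≤ ∑ t ∈ Finset.Icc 1 T, ENNReal.ofReal (c₁ * ‖s.z (t + 1) - s.z t‖
          + a.τ * Ch * (1 / a.β t) + c₂ * d (t + 1)) := Finset.sum_le_sum hterm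
    _ = ENNReal.ofReal (c₁ * ∑ t ∈ Finset.Icc 1 T, ‖s.z (t + 1) - s.z t‖
          + a.τ * Ch * ∑ t ∈ Finset.Icc 1 T, 1 / a.β t
          + c₂ * ∑ t ∈ Finset.Icc 1 T, d (t + 1)) := by
        rw [← ENNReal.ofReal_sum_of_nonneg, Finset.sum_add_distrib, Finset.sum_add_distrib,
          Finset.mul_sum, Finset.mul_sum, Finset.mul_sum]
        intro t _
        have := ha.β_pos t
        have := hd0 (t + 1)
        positivity
    _ ≤ ENNReal.ofReal (c₁ * (S * (T : ℝ) ^ (2 / 3 : ℝ))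
          + a.τ * Ch * (1 / (a.β₀ * a.ξ) * (3 / 2) * (T : ℝ) ^ (2 / 3 : ℝ))
          + c₂ * (S * (T : ℝ) ^ (2 / 3 : ℝ) + E * (T : ℝ) ^ (2 / 3 : ℝ))) := by
        apply ENNReal.ofReal_le_ofReal
        have hE : E ≤ E * (T : ℝ) ^ (2 / 3 : ℝ) := le_mul_of_one_le_right hE0 hT1
        gcongr
        linarith
    _ = _ := by congr 1; ring

end Rate

end OADMM

theorem theorem2 {n r m : ℕ} (P : OADMM.Problem n r m) (Lf Cg Ch : ℝ≥0) (Wh : ℝ)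
    (hP : P.Assumptions Lf Cg Ch Wh)
    (R : OADMM.Mat n r → OADMM.Mat n r → OADMM.Mat n r) (hR : OADMM.IsRetraction R)
    (a : OADMM.Params) (ha : a.Valid Wh) (hp : a.p = 1 / 3)
    (X₀ : OADMM.Mat n r) (hX₀ : X₀ ∈ OADMM.stiefel n r) (y₀ z₀ : OADMM.Vec m) :
    ∃ (J : ℕ) (C K : ℝ), 0 < C ∧ 0 < K ∧
      -- whenever `N` iterations are done, the next line search needs at most `J` trials
      (∀ (N : ℕ) (s : OADMM.Iterates n r m), P.IsRun R a X₀ y₀ z₀ N s →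
        ∀ v ∈ OADMM.limitingSubdiff P.g (s.X N), ∀ b ∈ Ioo a.bLow a.bHigh,
          ∃ j < J, P.TrialSucceeds R a s N v b j) ∧
      -- the average criticality measure over `T` iterations is at most `C T^(-1/3)`
      (∀ (T : ℕ), 1 ≤ T → ∀ s : OADMM.Iterates n r m, P.IsRun R a X₀ y₀ z₀ (T + 1) s →
        (∑ t ∈ Finset.Icc 1 T, P.crit (s.X (t + 1)) (s.yBr (t + 1)) (s.z (t + 1))) / (T : ℝ≥0∞)
          ≤ ENNReal.ofReal (C * (T : ℝ) ^ (-(1 / 3) : ℝ))) ∧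
      -- an `ε`-stationary point is found as soon as `T ≥ K / ε³`
      (∀ (ε : ℝ), 0 < ε → ∀ (T : ℕ), 1 ≤ T → K / ε ^ 3 ≤ (T : ℝ) →
        ∀ s : OADMM.Iterates n r m, P.IsRun R a X₀ y₀ z₀ (T + 1) s →
          ∃ t : ℕ, 1 ≤ t ∧ t ≤ T ∧
            P.IsStationary ε (s.X (t + 1)) (s.yBr (t + 1)) (s.z (t + 1))) := by
  obtain ⟨J, hJ⟩ := OADMM.exists_trialSucceeds (y₀ := y₀) (z₀ := z₀) hP hR ha hX₀
  obtain ⟨C, hC0, hC⟩ := OADMM.exists_sum_crit_bound (y₀ := y₀) (z₀ := z₀) hP hR ha hp hX₀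
  refine ⟨J + 1, C, C ^ 3, hC0, by positivity,
    fun N s h v hv b hb => ⟨J, Nat.lt_succ_self J, hJ N s h N le_rfl v hv b hb⟩, ?_, ?_⟩
  · intro T hT s h
    have hT0 : (0 : ℝ) < T := by exact_mod_cast hT
    rw [ENNReal.div_le_iff (by simpa using (show T ≠ 0 by omega)) (by simp)]
    refine (hC T hT s h).trans_eq ?_
    rw [← ENNReal.ofReal_natCast, ← ENNReal.ofReal_mul (by positivity), mul_assoc,
      ← Real.rpow_add_one hT0.ne']
    norm_num
  · intro ε hε T hT hK s h
    have hT0 : (0 : ℝ) < T := by exact_mod_cast hT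
    by_contra! hcon
    have hlt : ∀ t ∈ Finset.Icc 1 T,
        ENNReal.ofReal ε < P.crit (s.X (t + 1)) (s.yBr (t + 1)) (s.z (t + 1)) := by
      intro t ht
      obtain ⟨h1, h2⟩ := Finset.mem_Icc.1 ht
      by_contra! hle
      exact hcon t h1 h2 ⟨h.X_mem hR hX₀ (by omega), hle⟩
    have hsum := (ENNReal.sum_lt_sum_of_nonempty ⟨1, by simpa using hT⟩ hlt).trans_le
      (hC T hT s h)
    rw [Finset.sum_const, Nat.card_Icc, Nat.add_sub_cancel, nsmul_eq_mul,
      ← ENNReal.ofReal_natCast, ← ENNReal.ofReal_mul hT0.le] at hsum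
    have hsum' := (ENNReal.ofReal_lt_ofReal_iff_of_nonneg (by positivity)).1 hsum
    -- `T ε < C T^(2/3)` contradicts `C³ ≤ T ε³`
    have hθ : (T : ℝ) ^ (2 / 3 : ℝ) * (T : ℝ) ^ (1 / 3 : ℝ) = T := by
      rw [← Real.rpow_add hT0]; norm_num
    have hθ3 : ((T : ℝ) ^ (1 / 3 : ℝ)) ^ 3 = T := by
      rw [← Real.rpow_natCast, ← Real.rpow_mul hT0.le]; norm_num
    set θ := (T : ℝ) ^ (1 / 3 : ℝ)
    have hq : 0 < (T : ℝ) ^ (2 / 3 : ℝ) := by positivity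
    have h1 : θ * ε < C := by
      refine lt_of_mul_lt_mul_left ?_ hq.le
      calc (T : ℝ) ^ (2 / 3 : ℝ) * (θ * ε) = T * ε := by rw [← mul_assoc, hθ]
        _ < _ := by linarith
    have h2 : (θ * ε) ^ 3 < C ^ 3 := pow_lt_pow_left₀ h1 (by positivity) (by norm_num)
    rw [div_le_iff₀ (by positivity)] at hK
    rw [mul_pow, hθ3] at h2
    linarith
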